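/- Let $(\xi_n)_{n\in\mathbb Z}$ be a stationary Markov chain defined on a probability space $(\Omega,\mathcal F,\mathbb P)$ with values in a measurable space $(S,\mathcal A)$, and let $\pi$ be the law of $\xi_0$. Assume that the shift $\theta$ of $(\xi_n)_{n\in\mathbb Z}$ is totally ergodic, i.e. $\theta^m$ is ergodic, with respect to the law of $(\xi_n)_{n\in\mathbb Z}$ on $S^{\mathbb Z}$, for every integer $m\ge 1$. Let $f:S\to\mathbb R$ be measurable with $\int f^2\,d\pi<\infty$ and $\int f\,d\pi=0$, and put $X_i=f(\xi_i)$ and $S_n=\sum_{i=1}^n X_i$. Write $\|\cdot\|$ for the norm of $L^2(\Omega,\mathcal F,\mathbb P)$. Assume that $$\sum_{k\ge 1}\|E(X_0\mid \xi_{-k},\xi_k)\|^2<\infty .$$ Then the series $\sum_{k\ge1}E(X_0X_k)$ converges absolutely, the number $$\sigma^2=\|X_0\|^2+2\sum_{k\ge1}E(X_0X_k)$$ is nonnegative (and finite), $$\lim_{n\to\infty}\frac{E(S_n^2)}{n}=\sigma^2,$$ and $S_n/\sqrt n$ converges in distribution to $N(0,\sigma^2)$ as $n\to\infty$ (the point mass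 at $0$ if $\sigma^2=0$). -/

import Mathlib

open MeasureTheory ProbabilityTheory Filter Topology
open scoped NNReal

namespace TwoSidedChain

variable {Ω S : Type*} [MeasurableSpace Ω] [MeasurableSpace S]

/-- The trajectory map `ω ↦ (ξ_n(ω))_{n ∈ ℤ}` into the two-sided sequence space. -/
def path (ξ : ℤ → Ω → S) (ω : Ω) : ℤ → S := fun n => ξ n ω

/-- The left shift `θ` on the two-sided sequence space. -/
def shift (x : ℤ → S) : ℤ → S := fun n => x (n + 1)

/-- The law of the whole sequence, a measure on the product sigma-algebra of `S^ℤ`. -/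
noncomputable def pathLaw (ξ : ℤ → Ω → S) (μ : Measure Ω) : Measure (ℤ → S) :=
  μ.map (path ξ)

/-- `σ(ξ_k)`. -/
abbrev sigmaAt (ξ : ℤ → Ω → S) (k : ℤ) : MeasurableSpace Ω :=
  MeasurableSpace.comap (ξ k) inferInstance

/-- `F_n = σ(ξ_k, k ≤ n)`. -/
abbrev past (ξ : ℤ → Ω → S) (n : ℤ) : MeasurableSpace Ω :=
  ⨆ (k : ℤ) (_ : k ≤ n), sigmaAt ξ k

/-- `(ξ_n)_{n ∈ ℤ}` is a (strictly) stationary Markov chain with values in `S`. -/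
structure IsStationaryMarkovChain (ξ : ℤ → Ω → S) (μ : Measure Ω) : Prop where
  measurable : ∀ n, Measurable (ξ n)
  /-- The law of the sequence is invariant under the shift. -/
  stationary : MeasurePreserving shift (pathLaw ξ μ) (pathLaw ξ μ)
  /-- `P(ξ_{n+1} ∈ A | F_n) = P(ξ_{n+1} ∈ A | ξ_n)` almost surely. -/
  markov : ∀ (n : ℤ) (A : Set S), MeasurableSet A →
    μ[(ξ (n + 1) ⁻¹' A).indicator (fun _ => (1 : ℝ)) | past ξ n]
      =ᵐ[μ] μ[(ξ (n + 1) ⁻¹' A).indicator (fun _ => (1 : ℝ)) | sigmaAt ξ n]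

/-- Total ergodicity of the shift: `θ^m` is ergodic for every `m ≥ 1`. -/
def TotallyErgodic (ξ : ℤ → Ω → S) (μ : Measure Ω) : Prop :=
  ∀ m : ℕ, 1 ≤ m → Ergodic shift^[m] (pathLaw ξ μ)

/-- `f ∈ L²₀(π)`: `f` is measurable, `∫ f² dπ < ∞` and `∫ f dπ = 0`. -/
structure MemL20 (f : S → ℝ) (π : Measure S) : Prop where
  measurable : Measurable f
  memLp : MemLp f 2 π
  integral_eq_zero : ∫ x, f x ∂π = 0

/-- `X_i = f(ξ_i)`. -/
def obs (f : S → ℝ) (ξ : ℤ → Ω → S) (i : ℤ) (ω : Ω) : ℝ := f (ξ i ω)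

/-- `S_n = X_1 + ... + X_n`. -/
def partialSum (f : S → ℝ) (ξ : ℤ → Ω → S) (n : ℕ) (ω : Ω) : ℝ :=
  ∑ i ∈ Finset.Icc 1 n, obs f ξ (i : ℤ) ω

end TwoSidedChain

/-! Write `a_k = ‖E(X_0 | ξ_{-k}, ξ_k)‖`. Splitting at an intermediate time, the Markov property
gives `|E(X_0 X_{p+q})| ≤ a_p a_q` (`abs_integral_obs_mul_obs_le`). Hence `∑ a_k² < ∞` makes the
covariances absolutely summable, and `E(S_n²)/n → σ²` is a Cesàro limit.

For the central limit theorem, cut time into blocks of length `m` and let `D_l` be the `l`-th block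
sum minus its conditional expectation given the chain at the two ends of the block. By the two-sided
Markov property (`condExp_past_sup_future`), given the whole chain outside the block, `D_l` is
centered and its conditional variance `V_l` is a function of the two end states only. The outer
sigma-algebra of block `l` therefore contains every other `D_j` and every `V_j`, so the factors
`exp(iuD_l)` can be exchanged one at a time for `exp(-u²V_l/2)`, at the price of Taylor remainders
that need only second moments (`IsOuterCentered.norm_integral_prod_sub_le`). Ergodicity of `θ^m`
sends the averages of the `V_l` to `E(D_0²)` in `L¹`, so for fixed `m` the sum of the `D_l` has a
Gaussian limit.

Finally `m → ∞`. The discarded part `S_{mk} - ∑ D_l` is a sum of block means. It is measurable for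
every outer sigma-algebra, hence orthogonal to every `D_l`, and its squared norm is exactly
`E(S_{mk}²) - k E(D_0²)`; divided by `mk` this tends to `σ² - E(D_0²)/m` as `k → ∞`. Now `E(D_0²) =
E(S_m²) - ‖E(S_m | ξ_0, ξ_m)‖²`, and the last norm is at most `2 ∑_{j ≤ m} a_j = o(√m)`
(`lpNorm_condExp_partialSum_le`, `tendsto_sq_sum_div`), so the error disappears. The argument runs
on path space, where the shift acts, and is carried back along the trajectory map. -/

namespace TwoSidedChain

/-! ### Conditional expectation and `L²` geometry. -/

section CondExp

/-- Conditional expectations commute with measure-preserving maps. -/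
theorem condExp_comp_measurePreserving {α β : Type*} {mα : MeasurableSpace α}
    {m mβ : MeasurableSpace β} {μ : Measure α} {ν : Measure β} [IsFiniteMeasure μ]
    [IsFiniteMeasure ν] {φ : α → β} (hφ : MeasurePreserving φ μ ν)
    (hm : m ≤ mβ) {g : β → ℝ} (hg : Integrable g ν) :
    μ[g ∘ φ | m.comap φ] =ᵐ[μ] ν[g | m] ∘ φ := by
  have hle : m.comap φ ≤ mα := (MeasurableSpace.comap_mono hm).trans hφ.measurable.comap_le
  have hint : Integrable (ν[g | m] ∘ φ) μ := hφ.integrable_comp_of_integrable integrable_condExp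
  refine (ae_eq_condExp_of_forall_setIntegral_eq hle (hφ.integrable_comp_of_integrable hg)
    (fun s _ _ => hint.integrableOn) ?_ ?_).symm
  · rintro s ⟨t, ht, rfl⟩ -
    have ht' := hm t ht
    have key : ∀ h : β → ℝ, Integrable h ν → ∫ x in φ ⁻¹' t, (h ∘ φ) x ∂μ = ∫ y in t, h y ∂ν := by
      intro h hh
      rw [← hφ.map_eq, setIntegral_map ht' (by rw [hφ.map_eq]; exact hh.1) hφ.aemeasurable]
      rfl
    rw [key _ integrable_condExp, key _ hg, setIntegral_condExp hm hg ht]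
  · exact (stronglyMeasurable_condExp.comp_measurable (comap_measurable φ)).aestronglyMeasurable

theorem lpNorm_two_sq {Ω : Type*} {mΩ : MeasurableSpace Ω} {μ : Measure Ω} {Z : Ω → ℝ}
    (hZ : MemLp Z 2 μ) : lpNorm Z 2 μ ^ 2 = ∫ ω, Z ω ^ 2 ∂μ := by
  rw [lpNorm_eq_integral_norm_rpow_toReal (by simp) (by simp) hZ.1]
  have h : 0 ≤ ∫ ω, Z ω ^ 2 ∂μ := integral_nonneg fun _ => sq_nonneg _
  simp only [ENNReal.toReal_ofNat, Real.norm_eq_abs, Real.rpow_ofNat, sq_abs]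
  rw [← Real.rpow_natCast, ← Real.rpow_mul h]
  simp

/-- Cauchy–Schwarz, from the discriminant of the nonnegative quadratic `t ↦ ∫ (tZ + W)²`. -/
theorem abs_integral_mul_le {Ω : Type*} {mΩ : MeasurableSpace Ω} {μ : Measure Ω}
    {Z W : Ω → ℝ} (hZ : MemLp Z 2 μ) (hW : MemLp W 2 μ) :
    |∫ ω, Z ω * W ω ∂μ| ≤ lpNorm Z 2 μ * lpNorm W 2 μ := by
  refine abs_le_of_sq_le_sq ?_ (mul_nonneg lpNorm_nonneg lpNorm_nonneg)
  rw [mul_pow, lpNorm_two_sq hZ, lpNorm_two_sq hW]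
  have hZW : Integrable (fun ω => Z ω * W ω) μ := hZ.integrable_mul hW
  have h : ∀ t : ℝ, 0 ≤ (∫ ω, Z ω ^ 2 ∂μ) * (t * t) + (2 * ∫ ω, Z ω * W ω ∂μ) * t
      + ∫ ω, W ω ^ 2 ∂μ := by
    intro t
    have : (∫ ω, Z ω ^ 2 ∂μ) * (t * t) + (2 * ∫ ω, Z ω * W ω ∂μ) * t + ∫ ω, W ω ^ 2 ∂μ
        = ∫ ω, (t * Z ω + W ω) ^ 2 ∂μ := by
      have e : ∀ ω, (t * Z ω + W ω) ^ 2 = (t * t) * Z ω ^ 2 + (2 * t) * (Z ω * W ω) + W ω ^ 2 :=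
        fun ω => by ring
      have hi : Integrable (fun ω => (t * t) * Z ω ^ 2 + (2 * t) * (Z ω * W ω)) μ :=
        (hZ.integrable_sq.const_mul _).add (hZW.const_mul _)
      simp_rw [e]
      rw [integral_add hi hW.integrable_sq,
        integral_add (hZ.integrable_sq.const_mul _) (hZW.const_mul _), integral_const_mul,
        integral_const_mul]
      ring
    rw [this]
    exact integral_nonneg fun _ => sq_nonneg _
  have := discrim_le_zero h
  rw [discrim] at this
  nlinarith

variable {Ω : Type*} {mΩ : MeasurableSpace Ω} {μ : Measure Ω} [IsProbabilityMeasure μ]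

theorem integral_abs_le_lpNorm {Z : Ω → ℝ} (hZ : MemLp Z 2 μ) :
    ∫ ω, |Z ω| ∂μ ≤ lpNorm Z 2 μ := by
  have h := abs_integral_mul_le hZ.abs (memLp_const (μ := μ) (p := 2) (1 : ℝ))
  have e : lpNorm (fun _ : Ω => (1 : ℝ)) 2 μ = 1 := by
    rw [lpNorm_const' (by simp) (by simp)]; simp
  rw [e] at h
  simp only [mul_one] at h
  refine (le_abs_self _).trans (h.trans (le_of_eq ?_))
  exact lpNorm_fun_abs hZ.1 2

/-- A function measurable for `m` may be moved outside the conditional expectation given `m`. -/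
theorem integral_condExp_mul {m : MeasurableSpace Ω} (hm : m ≤ mΩ) {Z W : Ω → ℝ}
    (hW : StronglyMeasurable[m] W) (hZ : Integrable Z μ)
    (hZW : Integrable (fun ω => Z ω * W ω) μ) :
    ∫ ω, (μ[Z | m]) ω * W ω ∂μ = ∫ ω, Z ω * W ω ∂μ := by
  rw [← integral_condExp hm (f := fun ω => Z ω * W ω)]
  exact (integral_congr_ae (condExp_mul_of_stronglyMeasurable_right hW hZW hZ)).symm

/-- Tower property plus `L²` contraction. Every comparison with the norms `a_k` goes through this
monotonicity. -/
theorem lpNorm_condExp_mono {m₁ m₂ : MeasurableSpace Ω} (h₁₂ : m₁ ≤ m₂) (h₂ : m₂ ≤ mΩ)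
    {Z : Ω → ℝ} (hZ : MemLp Z 2 μ) : lpNorm (μ[Z | m₁]) 2 μ ≤ lpNorm (μ[Z | m₂]) 2 μ := by
  have e : μ[μ[Z | m₂] | m₁] =ᵐ[μ] μ[Z | m₁] := condExp_condExp_of_le h₁₂ h₂
  have := (hZ.condExp (m := m₂) (by simp)).lpNorm_condExp_le_lpNorm (m := m₁) (by simp)
  rwa [← toReal_eLpNorm integrable_condExp.1, eLpNorm_congr_ae e,
    toReal_eLpNorm integrable_condExp.1] at this

/-- Pythagoras for the orthogonal projection `Z ↦ E(Z | m)`. -/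
theorem integral_sub_condExp_sq {m : MeasurableSpace Ω} (hm : m ≤ mΩ) {Z : Ω → ℝ}
    (hZ : MemLp Z 2 μ) :
    ∫ ω, (Z ω - (μ[Z | m]) ω) ^ 2 ∂μ = ∫ ω, Z ω ^ 2 ∂μ - ∫ ω, (μ[Z | m]) ω ^ 2 ∂μ := by
  have hE : MemLp (μ[Z | m]) 2 μ := hZ.condExp (by simp)
  have h := integral_condExp_mul hm stronglyMeasurable_condExp (hZ.integrable (by simp))
    (hZ.integrable_mul hE)
  have e : ∀ ω, (Z ω - (μ[Z | m]) ω) ^ 2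
      = Z ω ^ 2 + (μ[Z | m]) ω ^ 2 - 2 * (Z ω * (μ[Z | m]) ω) := fun ω => by ring
  have hi : Integrable (fun ω => Z ω ^ 2 + (μ[Z | m]) ω ^ 2) μ :=
    hZ.integrable_sq.add hE.integrable_sq
  have hi' : Integrable (fun ω => Z ω * (μ[Z | m]) ω) μ := hZ.integrable_mul hE
  simp_rw [e]
  rw [integral_sub hi (hi'.const_mul 2),
    integral_add hZ.integrable_sq hE.integrable_sq, integral_const_mul]
  simp only [← pow_two] at h
  linarith

end CondExp

/-! ### Mean ergodic theorem in `L¹`. -/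

section Ergodic

variable {Ω : Type*} {mΩ : MeasurableSpace Ω} {μ : Measure Ω} [IsProbabilityMeasure μ]
  {T : Ω → Ω}

theorem integral_comp_measurePreserving {α β : Type*} {mα : MeasurableSpace α}
    {mβ : MeasurableSpace β} {μ : Measure α} {ν : Measure β} {F : Type*} [NormedAddCommGroup F]
    [NormedSpace ℝ F] {φ : α → β} (hφ : MeasurePreserving φ μ ν) {g : β → F}
    (hg : AEStronglyMeasurable g ν) : ∫ x, g (φ x) ∂μ = ∫ y, g y ∂ν := by
  rw [← hφ.map_eq, integral_map hφ.aemeasurable (by rwa [hφ.map_eq])]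

/-- Von Neumann's theorem for the Koopman operator on `L²`: the averages converge to the projection
on the invariant vectors, and ergodicity makes an invariant vector constant. -/
theorem tendsto_integral_abs_average_sub_of_memLp_two (hT : Ergodic T μ) {W : Ω → ℝ}
    (hW : MemLp W 2 μ) :
    Tendsto (fun N : ℕ => ∫ ω, |(∑ j ∈ Finset.range N, W (T^[j] ω)) / N - ∫ ω, W ω ∂μ| ∂μ)
      atTop (𝓝 0) := by
  set U : Lp ℝ 2 μ →L[ℝ] Lp ℝ 2 μ :=
    (Lp.compMeasurePreservingₗᵢ ℝ T hT.toMeasurePreserving).toContinuousLinearMap with hU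
  have hUn : ‖U‖ ≤ 1 := LinearIsometry.norm_toContinuousLinearMap_le _
  have hUc : ∀ g : Lp ℝ 2 μ, U g =ᵐ[μ] g ∘ T :=
    fun g => Lp.coeFn_compMeasurePreserving g hT.toMeasurePreserving
  set x : Lp ℝ 2 μ := hW.toLp W
  set p : Lp ℝ 2 μ := ↑((U.eqLocus (1 : Lp ℝ 2 μ →L[ℝ] Lp ℝ 2 μ)).orthogonalProjectionOnto x)
  have hlim : Tendsto (birkhoffAverage ℝ U _root_.id · x) atTop (𝓝 p) :=
    ContinuousLinearMap.tendsto_birkhoffAverage_orthogonalProjection U hUn x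
  have hUp : U p = p :=
    ((U.eqLocus (1 : Lp ℝ 2 μ →L[ℝ] Lp ℝ 2 μ)).orthogonalProjectionOnto x).2
  obtain ⟨c, hc⟩ := hT.ae_eq_const_of_ae_eq_comp_ae (Lp.aestronglyMeasurable p)
    (by have := hUc p; rw [hUp] at this; exact this.symm)
  have hiter : ∀ j : ℕ, (U^[j] x : Lp ℝ 2 μ) =ᵐ[μ] fun ω => W (T^[j] ω) := by
    intro j
    induction j with
    | zero => exact hW.coeFn_toLp
    | succ j ih =>
      rw [Function.iterate_succ_apply']
      refine (hUc _).trans ?_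
      have := hT.toMeasurePreserving.quasiMeasurePreserving.ae_eq_comp ih
      refine this.trans (.of_forall fun ω => ?_)
      simp [Function.iterate_succ_apply]
  have havg : ∀ N : ℕ, (birkhoffAverage ℝ U _root_.id N x : Lp ℝ 2 μ)
      =ᵐ[μ] fun ω => (∑ j ∈ Finset.range N, W (T^[j] ω)) / N := by
    intro N
    rw [birkhoffAverage, birkhoffSum]
    refine (Lp.coeFn_smul _ _).trans ?_
    have h1 := Lp.coeFn_finsetSum (Finset.range N) (fun j => (U^[j] x : Lp ℝ 2 μ))
    have h2 : ∀ᵐ ω ∂μ, ∀ j : ℕ, (U^[j] x : Lp ℝ 2 μ) ω = W (T^[j] ω) := ae_all_iff.2 hiter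
    filter_upwards [h1, h2] with ω h1 h2
    simp only [_root_.id, Pi.smul_apply, smul_eq_mul]
    rw [h1]
    simp only [Finset.sum_apply, h2]
    rw [div_eq_inv_mul]
  have hbound : ∀ N : ℕ, ∫ ω, |(∑ j ∈ Finset.range N, W (T^[j] ω)) / N - c| ∂μ
      ≤ ‖birkhoffAverage ℝ U _root_.id N x - p‖ := by
    intro N
    set z := birkhoffAverage ℝ U _root_.id N x - p
    have hz : z =ᵐ[μ] fun ω => (∑ j ∈ Finset.range N, W (T^[j] ω)) / N - c := by
      refine (Lp.coeFn_sub _ _).trans ?_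
      filter_upwards [havg N, hc] with ω h1 h2
      simp [h1, h2]
    have h3 := integral_abs_le_lpNorm (Lp.memLp z)
    rw [← toReal_eLpNorm (Lp.aestronglyMeasurable z), ← Lp.norm_def] at h3
    refine (integral_congr_ae ?_).trans_le h3
    filter_upwards [hz] with ω h
    rw [h]
  have hto0 : Tendsto (fun N : ℕ => ∫ ω, |(∑ j ∈ Finset.range N, W (T^[j] ω)) / N - c| ∂μ)
      atTop (𝓝 0) := by
    refine squeeze_zero (fun N => integral_nonneg fun _ => abs_nonneg _) hbound ?_
    exact tendsto_iff_norm_sub_tendsto_zero.1 hlim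
  -- Each average has integral `∫ W`, so `|∫ W - c|` is at most the `L¹` distance from the average
  -- to `c`, which tends to `0`.
  have hcW : c = ∫ ω, W ω ∂μ := by
    have hWi : Integrable W μ := hW.integrable (by simp)
    have hWj : ∀ j : ℕ, Integrable (fun ω => W (T^[j] ω)) μ := fun j =>
      (hT.toMeasurePreserving.iterate j).integrable_comp_of_integrable hWi
    have key : ∀ᶠ N : ℕ in atTop, |∫ ω, W ω ∂μ - c|
        ≤ ∫ ω, |(∑ j ∈ Finset.range N, W (T^[j] ω)) / N - c| ∂μ := by
      filter_upwards [eventually_gt_atTop 0] with N hN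
      have e : ∫ ω, W ω ∂μ - c = ∫ ω, ((∑ j ∈ Finset.range N, W (T^[j] ω)) / N - c) ∂μ := by
        rw [integral_sub ((integrable_finsetSum _ fun j _ => hWj j).div_const _)
          (integrable_const c), integral_div, integral_finsetSum _ fun j _ => hWj j]
        have : ∀ j, ∫ ω, W (T^[j] ω) ∂μ = ∫ ω, W ω ∂μ := fun j =>
          integral_comp_measurePreserving (hT.toMeasurePreserving.iterate j) hWi.1
        simp only [this, Finset.sum_const, Finset.card_range, nsmul_eq_mul, integral_const,
          probReal_univ, smul_eq_mul, one_mul]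
        field_simp
      rw [e]
      exact abs_integral_le_integral_abs
    have := ge_of_tendsto hto0 key
    have := abs_nonpos_iff.1 this
    linarith
  rwa [hcW] at hto0

/-- The mean ergodic theorem in `L¹`. -/
theorem tendsto_integral_abs_average_sub (hT : Ergodic T μ) {V : Ω → ℝ} (hV : Integrable V μ) :
    Tendsto (fun N : ℕ => ∫ ω, |(∑ j ∈ Finset.range N, V (T^[j] ω)) / N - ∫ ω, V ω ∂μ| ∂μ)
      atTop (𝓝 0) := by
  refine Metric.tendsto_atTop.2 fun ε hε => ?_
  -- A simple function is in `L²`, so the previous case applies to it. The error splits into three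
  -- parts below `ε/4`: averages of `V - W`, the `L²` case for `W`, and the difference of the means.
  obtain ⟨W, hWV, -⟩ := (memLp_one_iff_integrable.2 hV).exists_simpleFunc_eLpNorm_sub_lt
    (by simp) (ENNReal.ofReal_pos.2 (show 0 < ε / 4 by positivity)).ne'
  have hW2 : MemLp W 2 μ := W.memLp_of_isFiniteMeasure 2 μ
  have hWi : Integrable W μ := hW2.integrable (by simp)
  have hclose : ∫ ω, |V ω - W ω| ∂μ < ε / 4 := by
    have h : lpNorm (V - ⇑W) 1 μ = ∫ ω, |V ω - W ω| ∂μ := by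
      rw [lpNorm_one_eq_integral_norm (hV.sub hWi).1]; rfl
    rw [← h, ← toReal_eLpNorm (hV.sub hWi).1]
    exact (ENNReal.lt_ofReal_iff_toReal_lt hWV.ne_top).1 hWV
  obtain ⟨N₀, hN₀⟩ := Metric.tendsto_atTop.1
    (tendsto_integral_abs_average_sub_of_memLp_two hT hW2) (ε / 4) (by positivity)
  refine ⟨max N₀ 1, fun N hN => ?_⟩
  have hN1 : 0 < N := (le_max_right _ _).trans hN
  have h4 := hN₀ N ((le_max_left _ _).trans hN)
  rw [Real.dist_0_eq_abs, abs_of_nonneg (integral_nonneg fun _ => abs_nonneg _)] at h4 ⊢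
  have hdj : ∀ j : ℕ, Integrable (fun ω => |V (T^[j] ω) - W (T^[j] ω)|) μ := fun j =>
    (hT.toMeasurePreserving.iterate j).integrable_comp_of_integrable (hV.sub hWi).abs
  have hVj : ∀ j : ℕ, Integrable (fun ω => V (T^[j] ω)) μ := fun j =>
    (hT.toMeasurePreserving.iterate j).integrable_comp_of_integrable hV
  have hWj : ∀ j : ℕ, Integrable (fun ω => W (T^[j] ω)) μ := fun j =>
    (hT.toMeasurePreserving.iterate j).integrable_comp_of_integrable hWi
  have hdint : ∀ j : ℕ, ∫ ω, |V (T^[j] ω) - W (T^[j] ω)| ∂μ = ∫ ω, |V ω - W ω| ∂μ := fun j =>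
    integral_comp_measurePreserving (g := fun ω => |V ω - W ω|)
      (hT.toMeasurePreserving.iterate j) (hV.sub hWi).abs.1
  have hmean : |∫ ω, W ω ∂μ - ∫ ω, V ω ∂μ| ≤ ∫ ω, |V ω - W ω| ∂μ := by
    rw [abs_sub_comm, ← integral_sub hV hWi]
    exact abs_integral_le_integral_abs
  have hpt : ∀ ω, |(∑ j ∈ Finset.range N, V (T^[j] ω)) / N - ∫ ω, V ω ∂μ|
      ≤ (∑ j ∈ Finset.range N, |V (T^[j] ω) - W (T^[j] ω)|) / N
        + |(∑ j ∈ Finset.range N, W (T^[j] ω)) / N - ∫ ω, W ω ∂μ| + ∫ ω, |V ω - W ω| ∂μ := by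
    intro ω
    have e : (∑ j ∈ Finset.range N, V (T^[j] ω)) / N - ∫ ω, V ω ∂μ
        = (∑ j ∈ Finset.range N, (V (T^[j] ω) - W (T^[j] ω))) / N
          + ((∑ j ∈ Finset.range N, W (T^[j] ω)) / N - ∫ ω, W ω ∂μ)
          + (∫ ω, W ω ∂μ - ∫ ω, V ω ∂μ) := by
      rw [Finset.sum_sub_distrib]; ring
    rw [e]
    refine (abs_add_three _ _ _).trans ?_
    gcongr
    rw [abs_div, Nat.abs_cast]
    gcongr
    exact Finset.abs_sum_le_sum_abs _ _
  have hi1 : Integrable (fun ω => (∑ j ∈ Finset.range N, |V (T^[j] ω) - W (T^[j] ω)|) / N) μ :=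
    (integrable_finsetSum _ fun j _ => hdj j).div_const _
  have hi2 : Integrable
      (fun ω => |(∑ j ∈ Finset.range N, W (T^[j] ω)) / N - ∫ ω, W ω ∂μ|) μ :=
    (((integrable_finsetSum _ fun j _ => hWj j).div_const _).sub (integrable_const _)).abs
  have hi0 : Integrable
      (fun ω => |(∑ j ∈ Finset.range N, V (T^[j] ω)) / N - ∫ ω, V ω ∂μ|) μ :=
    (((integrable_finsetSum _ fun j _ => hVj j).div_const _).sub (integrable_const _)).abs
  have hi12 : Integrable (fun ω => (∑ j ∈ Finset.range N, |V (T^[j] ω) - W (T^[j] ω)|) / N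
      + |(∑ j ∈ Finset.range N, W (T^[j] ω)) / N - ∫ ω, W ω ∂μ|) μ := hi1.add hi2
  have h5 := integral_mono hi0 (hi12.add (integrable_const _)) hpt
  simp only [Pi.add_apply] at h5
  rw [integral_add hi12 (integrable_const _), integral_add hi1 hi2, integral_div,
    integral_finsetSum _ fun j _ => hdj j] at h5
  simp only [hdint, Finset.sum_const, Finset.card_range, nsmul_eq_mul, integral_const,
    probReal_univ, smul_eq_mul, one_mul] at h5
  rw [mul_div_cancel_left₀ _ (by positivity)] at h5
  linarith

end Ergodic

/-! ### Taylor remainders under second-moment assumptions. -/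

section Taylor

/-- The second-order Taylor remainder of `x ↦ exp (i x)` at `0`. -/
noncomputable def expRem (x : ℝ) : ℂ :=
  Complex.exp (Complex.I * x) - 1 - Complex.I * x + x ^ 2 / 2

theorem continuous_expRem : Continuous expRem := by
  unfold expRem
  fun_prop

theorem norm_expRem_le_cube (x : ℝ) : ‖expRem x‖ ≤ |x| ^ 3 * Real.exp |x| := by
  have h := Complex.norm_exp_sub_sum_le_norm_mul_exp (Complex.I * x) 3
  have e : Complex.exp (Complex.I * x)
      - ∑ m ∈ Finset.range 3, (Complex.I * x) ^ m / (m.factorial : ℂ) = expRem x := by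
    simp [Finset.sum_range_succ, expRem, mul_pow]
    ring
  rw [e] at h
  simpa using h

/-- The cubic bound suffices for `|x| ≤ 1`; beyond that each term of the remainder is bounded
separately. This bound provides domination, the cubic one pointwise convergence. -/
theorem norm_expRem_le_sq (x : ℝ) : ‖expRem x‖ ≤ 4 * x ^ 2 := by
  rcases le_total |x| 1 with hx | hx
  · refine (norm_expRem_le_cube x).trans ?_
    have h1 : Real.exp |x| ≤ 4 := by
      have := Real.exp_le_exp.2 hx
      have := Real.exp_one_lt_d9
      linarith
    calc |x| ^ 3 * Real.exp |x| = |x| * |x| ^ 2 * Real.exp |x| := by ring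
      _ ≤ 1 * |x| ^ 2 * 4 := by gcongr
      _ = 4 * x ^ 2 := by rw [sq_abs]; ring
  · have h0 : ‖Complex.exp (Complex.I * x)‖ = 1 := by
      rw [mul_comm]; exact Complex.norm_exp_ofReal_mul_I x
    have h1 : ‖expRem x‖ ≤ 1 + 1 + |x| + x ^ 2 / 2 := by
      unfold expRem
      refine (norm_add_le _ _).trans ?_
      refine add_le_add ((norm_sub_le _ _).trans (add_le_add ((norm_sub_le _ _).trans ?_) ?_)) ?_
      · rw [h0]; simp
      · simp
      · simp
    have h2 : 1 ≤ x ^ 2 := by rw [← sq_abs]; nlinarith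
    have h3 : |x| ≤ x ^ 2 := by rw [← sq_abs]; nlinarith
    linarith

/-- The first-order Taylor remainder of `y ↦ exp (-y)` at `0`. -/
noncomputable def expNegRem (y : ℝ) : ℝ := Real.exp (-y) - 1 + y

theorem continuous_expNegRem : Continuous expNegRem := by
  unfold expNegRem
  fun_prop

theorem expNegRem_nonneg (y : ℝ) : 0 ≤ expNegRem y := by
  have := Real.add_one_le_exp (-y)
  unfold expNegRem
  linarith

theorem expNegRem_le {y : ℝ} (hy : 0 ≤ y) : expNegRem y ≤ y := by
  have : Real.exp (-y) ≤ 1 := Real.exp_le_one_iff.2 (by linarith)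
  unfold expNegRem
  linarith

theorem expNegRem_le_sq {y : ℝ} (hy : |y| ≤ 1) : expNegRem y ≤ y ^ 2 := by
  have h := Real.norm_exp_sub_one_sub_id_le (x := -y) (by simpa using hy)
  have := (le_abs_self _).trans h
  simp only [Real.norm_eq_abs, sq_abs, abs_neg] at this
  unfold expNegRem
  linarith

variable {Ω : Type*} {mΩ : MeasurableSpace Ω} {μ : Measure Ω}

/-- Factor out `u²K → τ`: what is left is the integral of `D²` times the bounded ratio `‖expRem
(uD)‖ / (uD)²`, which tends to `0` pointwise. Dominated convergence by `4D²` then needs no moment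
above the second. -/
theorem tendsto_integral_expRem {D : Ω → ℝ} (hD : MemLp D 2 μ) {u : ℕ → ℝ} {K : ℕ → ℕ} {τ : ℝ}
    (hu : Tendsto u atTop (𝓝 0)) (huK : Tendsto (fun n => u n ^ 2 * K n) atTop (𝓝 τ)) :
    Tendsto (fun n => (K n : ℝ) * ∫ ω, ‖expRem (u n * D ω)‖ ∂μ) atTop (𝓝 0) := by
  have hmain : Tendsto (fun n => ∫ ω, D ω ^ 2 * (‖expRem (u n * D ω)‖ / (u n * D ω) ^ 2) ∂μ)
      atTop (𝓝 (∫ _, (0 : ℝ) ∂μ)) := by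
    refine tendsto_integral_of_dominated_convergence (fun ω => D ω ^ 2 * 4) (fun n => ?_)
      (hD.integrable_sq.mul_const _) (fun n => .of_forall fun ω => ?_) (.of_forall fun ω => ?_)
    · have := hD.1.aemeasurable
      have h2 := continuous_expRem.measurable.comp_aemeasurable (this.const_mul (u n))
      exact ((this.pow_const 2).mul
        (h2.norm.div ((this.const_mul (u n)).pow_const 2))).aestronglyMeasurable
    · rw [Real.norm_of_nonneg (by positivity)]
      gcongr
      refine div_le_of_le_mul₀ (by positivity) (by norm_num) (norm_expRem_le_sq _)
    · have hb : ∀ n, D ω ^ 2 * (‖expRem (u n * D ω)‖ / (u n * D ω) ^ 2)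
          ≤ D ω ^ 2 * (|u n * D ω| * Real.exp |u n * D ω|) := by
        intro n
        gcongr
        refine div_le_of_le_mul₀ (by positivity) (by positivity) ((norm_expRem_le_cube _).trans ?_)
        rw [← sq_abs (u n * D ω)]
        exact le_of_eq (by ring)
      refine squeeze_zero (fun n => by positivity) hb ?_
      have h1 : Tendsto (fun n => u n * D ω) atTop (𝓝 0) := by simpa using hu.mul_const (D ω)
      have h2 : Continuous fun x : ℝ => D ω ^ 2 * (|x| * Real.exp |x|) := by fun_prop
      have h3 := (h2.tendsto 0).comp h1
      rwa [abs_zero, zero_mul, mul_zero] at h3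
  have := huK.mul hmain
  simp only [integral_zero, mul_zero] at this
  refine this.congr fun n => ?_
  rw [mul_comm (u n ^ 2), mul_assoc, ← integral_const_mul]
  congr 1
  refine integral_congr_ae (.of_forall fun ω => ?_)
  -- Where `uD = 0` the ratio is `0 / 0 = 0` and the remainder itself vanishes, so the factorization
  -- remains exact.
  by_cases h : u n * D ω = 0
  · simp [h, expRem]
  · have h1 : u n ≠ 0 := left_ne_zero_of_mul h
    have h2 : D ω ≠ 0 := right_ne_zero_of_mul h
    simp only
    field_simp

/-- The same factorization one order lower: `expNegRem y / y` lies in `[0, 1]` for `y ≥ 0` and tends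
to `0` with `y`, so `V` dominates. -/
theorem tendsto_integral_expNegRem {V : Ω → ℝ} (hV : Integrable V μ) (hV0 : ∀ ω, 0 ≤ V ω)
    {u : ℕ → ℝ} {K : ℕ → ℕ} {τ : ℝ}
    (hu : Tendsto u atTop (𝓝 0)) (huK : Tendsto (fun n => u n ^ 2 * K n) atTop (𝓝 τ)) :
    Tendsto (fun n => (K n : ℝ) * ∫ ω, expNegRem (u n ^ 2 / 2 * V ω) ∂μ) atTop (𝓝 0) := by
  have hmain : Tendsto
      (fun n => ∫ ω, V ω * (expNegRem (u n ^ 2 / 2 * V ω) / (u n ^ 2 / 2 * V ω)) ∂μ)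
      atTop (𝓝 (∫ _, (0 : ℝ) ∂μ)) := by
    have hnn : ∀ n ω, 0 ≤ V ω * (expNegRem (u n ^ 2 / 2 * V ω) / (u n ^ 2 / 2 * V ω)) :=
      fun n ω => mul_nonneg (hV0 ω)
        (div_nonneg (expNegRem_nonneg _) (mul_nonneg (by positivity) (hV0 ω)))
    refine tendsto_integral_of_dominated_convergence V (fun n => ?_)
      hV (fun n => .of_forall fun ω => ?_) (.of_forall fun ω => ?_)
    · have := hV.1.aemeasurable
      have h2 := continuous_expNegRem.measurable.comp_aemeasurable (this.const_mul (u n ^ 2 / 2))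
      exact (this.mul (h2.div (this.const_mul (u n ^ 2 / 2)))).aestronglyMeasurable
    · rw [Real.norm_of_nonneg (hnn n ω)]
      have h0 : 0 ≤ u n ^ 2 / 2 * V ω := mul_nonneg (by positivity) (hV0 ω)
      refine mul_le_of_le_one_right (hV0 ω) (div_le_one_of_le₀ (expNegRem_le h0) h0)
    · have h1 : Tendsto (fun n => u n ^ 2 / 2 * V ω) atTop (𝓝 0) := by
        simpa using ((hu.pow 2).div_const 2).mul_const (V ω)
      have hsmall : ∀ᶠ n in atTop, |u n ^ 2 / 2 * V ω| ≤ 1 := by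
        have := h1.abs
        rw [abs_zero] at this
        exact (this.eventually (ge_mem_nhds one_pos))
      refine squeeze_zero' (.of_forall fun n => hnn n ω) (g := fun n =>
        V ω * (u n ^ 2 / 2 * V ω)) ?_ (by simpa using h1.const_mul (V ω))
      filter_upwards [hsmall] with n hn
      have h0 : 0 ≤ u n ^ 2 / 2 * V ω := mul_nonneg (by positivity) (hV0 ω)
      refine mul_le_mul_of_nonneg_left ?_ (hV0 ω)
      refine div_le_of_le_mul₀ h0 h0 ((expNegRem_le_sq hn).trans (le_of_eq (by ring)))
  have := (huK.div_const 2).mul hmain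
  simp only [integral_zero, mul_zero] at this
  refine this.congr fun n => ?_
  rw [show u n ^ 2 * K n / 2 = K n * (u n ^ 2 / 2) by ring, mul_assoc, ← integral_const_mul]
  congr 1
  refine integral_congr_ae (.of_forall fun ω => ?_)
  by_cases h : u n ^ 2 / 2 * V ω = 0
  · simp [h, expNegRem]
  · have h1 : u n ≠ 0 := fun h' => h (by simp [h'])
    have h2 : V ω ≠ 0 := right_ne_zero_of_mul h
    simp only
    field_simp

end Taylor

/-! ### Central limit theorem for outer-centered variables. -/

section BlockCLT

variable {Ω : Type*} {mΩ : MeasurableSpace Ω} {μ : Measure Ω} [IsProbabilityMeasure μ]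

theorem integral_mul_eq_zero_of_condExp {m : MeasurableSpace Ω} (hm : m ≤ mΩ) {Z W : Ω → ℝ}
    (hZ : Integrable Z μ) (hZ0 : μ[Z | m] =ᵐ[μ] 0) (hW : StronglyMeasurable[m] W)
    (hZW : Integrable (fun ω => Z ω * W ω) μ) : ∫ ω, Z ω * W ω ∂μ = 0 := by
  rw [← integral_condExp_mul hm hW hZ hZW]
  refine integral_eq_zero_of_ae ?_
  filter_upwards [hZ0] with ω h
  simp [h]

theorem integral_complex_mul_eq_zero_of_condExp {Ω : Type*} {m mΩ : MeasurableSpace Ω}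
    {μ : Measure Ω} [IsProbabilityMeasure μ] (hm : m ≤ mΩ) {Z : Ω → ℝ} {W : Ω → ℂ}
    (hZ : Integrable Z μ) (hZ0 : μ[Z | m] =ᵐ[μ] 0) (hW : StronglyMeasurable[m] W)
    (hW1 : ∀ ω, ‖W ω‖ ≤ 1) : ∫ ω, W ω * (Z ω : ℂ) ∂μ = 0 := by
  have hWm : AEStronglyMeasurable[mΩ] W μ := (hW.mono hm).aestronglyMeasurable
  have hi : Integrable (fun ω => W ω * (Z ω : ℂ)) μ :=
    hZ.ofReal.bdd_mul hWm (.of_forall hW1)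
  have hre : StronglyMeasurable[m] fun ω => (W ω).re :=
    Complex.continuous_re.comp_stronglyMeasurable hW
  have him : StronglyMeasurable[m] fun ω => (W ω).im :=
    Complex.continuous_im.comp_stronglyMeasurable hW
  apply Complex.ext
  · rw [← integral_re_add_im hi]
    have h := integral_mul_eq_zero_of_condExp hm hZ hZ0 hre
      (hZ.mul_bdd (hre.mono hm).aestronglyMeasurable
        (.of_forall fun ω => (Complex.abs_re_le_norm _).trans (hW1 ω)))
    simp [mul_comm, h]
  · rw [← integral_re_add_im hi]
    have h := integral_mul_eq_zero_of_condExp hm hZ hZ0 him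
      (hZ.mul_bdd (him.mono hm).aestronglyMeasurable
        (.of_forall fun ω => (Complex.abs_im_le_norm _).trans (hW1 ω)))
    simp [mul_comm, h]

/-- One exchange in the Lindeberg scheme. To second order the two exponentials differ by `iuD -
u²(D² - V)/2`, and both `D` and `D² - V` are conditionally centered, hence vanish against the
`m`-measurable weight `W`. Only the remainders survive. -/
theorem norm_integral_mul_exp_sub_le {m : MeasurableSpace Ω} (hm : m ≤ mΩ) {D V : Ω → ℝ}
    {W : Ω → ℂ} (hD : MemLp D 2 μ) (hV : Integrable V μ) (hVm : StronglyMeasurable[m] V)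
    (hV0 : ∀ ω, 0 ≤ V ω) (hD0 : μ[D | m] =ᵐ[μ] 0) (hDV : μ[fun ω => D ω ^ 2 | m] =ᵐ[μ] V)
    (hW : StronglyMeasurable[m] W) (hW1 : ∀ ω, ‖W ω‖ ≤ 1) (u : ℝ) :
    ‖∫ ω, W ω * (Complex.exp (Complex.I * (u * D ω : ℝ)) - (Real.exp (-(u ^ 2 / 2 * V ω)) : ℂ)) ∂μ‖
      ≤ ∫ ω, ‖expRem (u * D ω)‖ ∂μ + ∫ ω, expNegRem (u ^ 2 / 2 * V ω) ∂μ := by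
  have hWm : AEStronglyMeasurable[mΩ] W μ := (hW.mono hm).aestronglyMeasurable
  have hDi : Integrable D μ := hD.integrable (by simp)
  have hZ : Integrable (fun ω => D ω ^ 2 - V ω) μ := hD.integrable_sq.sub hV
  have hZ0 : μ[fun ω => D ω ^ 2 - V ω | m] =ᵐ[μ] 0 := by
    refine (condExp_sub hD.integrable_sq hV m).trans ?_
    rw [condExp_of_stronglyMeasurable hm hVm hV]
    filter_upwards [hDV] with ω h
    simp [h]
  have h1 := integral_complex_mul_eq_zero_of_condExp hm hDi hD0 hW hW1
  have h2 := integral_complex_mul_eq_zero_of_condExp hm hZ hZ0 hW hW1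
  have hr : Integrable (fun ω => expRem (u * D ω)) μ := by
    refine (hD.integrable_sq.const_mul (4 * u ^ 2)).mono'
      (continuous_expRem.comp_aestronglyMeasurable (hD.1.const_mul u)) (.of_forall fun ω => ?_)
    exact (norm_expRem_le_sq _).trans (le_of_eq (by ring))
  have hs : Integrable (fun ω => expNegRem (u ^ 2 / 2 * V ω)) μ := by
    refine (hV.const_mul (u ^ 2 / 2)).mono'
      (continuous_expNegRem.comp_aestronglyMeasurable (hV.1.const_mul _)) (.of_forall fun ω => ?_)
    rw [Real.norm_of_nonneg (expNegRem_nonneg _)]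
    exact expNegRem_le (mul_nonneg (by positivity) (hV0 ω))
  have i1 : Integrable (fun ω => W ω * expRem (u * D ω)) μ := hr.bdd_mul hWm (.of_forall hW1)
  have i2 : Integrable (fun ω => W ω * (expNegRem (u ^ 2 / 2 * V ω) : ℂ)) μ :=
    hs.ofReal.bdd_mul hWm (.of_forall hW1)
  have i3 : Integrable (fun ω => Complex.I * u * (W ω * (D ω : ℂ))) μ :=
    (hDi.ofReal.bdd_mul hWm (.of_forall hW1)).const_mul _
  have i4 : Integrable (fun ω => (u ^ 2 / 2 : ℂ) * (W ω * ((D ω ^ 2 - V ω : ℝ) : ℂ))) μ :=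
    (hZ.ofReal.bdd_mul hWm (.of_forall hW1)).const_mul _
  have i12 : Integrable (fun ω => W ω * expRem (u * D ω)
      - W ω * (expNegRem (u ^ 2 / 2 * V ω) : ℂ)) μ := i1.sub i2
  have i123 : Integrable (fun ω => W ω * expRem (u * D ω)
      - W ω * (expNegRem (u ^ 2 / 2 * V ω) : ℂ) + Complex.I * u * (W ω * (D ω : ℂ))) μ := i12.add i3
  have e : ∀ ω, W ω * (Complex.exp (Complex.I * (u * D ω : ℝ))
      - (Real.exp (-(u ^ 2 / 2 * V ω)) : ℂ))
      = W ω * expRem (u * D ω) - W ω * (expNegRem (u ^ 2 / 2 * V ω) : ℂ)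
        + Complex.I * u * (W ω * (D ω : ℂ))
        - (u ^ 2 / 2 : ℂ) * (W ω * ((D ω ^ 2 - V ω : ℝ) : ℂ)) := by
    intro ω
    simp only [expRem, expNegRem]
    push_cast
    ring
  simp_rw [e]
  rw [integral_sub i123 i4, integral_add i12 i3, integral_const_mul, integral_const_mul, h1, h2,
    mul_zero, mul_zero, add_zero, sub_zero, integral_sub i1 i2]
  refine (norm_sub_le _ _).trans (add_le_add ?_ ?_)
  · refine norm_integral_le_of_norm_le hr.norm (.of_forall fun ω => ?_)
    rw [norm_mul]
    exact mul_le_of_le_one_left (norm_nonneg _) (hW1 ω)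
  · refine norm_integral_le_of_norm_le hs (.of_forall fun ω => ?_)
    rw [norm_mul, Complex.norm_real, Real.norm_of_nonneg (expNegRem_nonneg _)]
    exact mul_le_of_le_one_left (expNegRem_nonneg _) (hW1 ω)

/-- Square-integrable variables `D j` which, conditionally on the outer sigma-algebras `H j`,
are centered with conditional variance `V j`; every `D l` with `l ≠ j` and every `V l`
is `H j`-measurable. -/
structure IsOuterCentered (D V : ℕ → Ω → ℝ) (H : ℕ → MeasurableSpace Ω) (μ : Measure Ω) :
    Prop where
  le : ∀ j, H j ≤ mΩ
  memLp : ∀ j, MemLp (D j) 2 μ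
  integrable : ∀ j, Integrable (V j) μ
  nonneg : ∀ j ω, 0 ≤ V j ω
  measurable_of_ne : ∀ l j, l ≠ j → StronglyMeasurable[H j] (D l)
  measurable_var : ∀ l j, StronglyMeasurable[H j] (V l)
  condExp_eq_zero : ∀ j, μ[D j | H j] =ᵐ[μ] 0
  condExp_sq : ∀ j, μ[fun ω => D j ω ^ 2 | H j] =ᵐ[μ] V j

theorem IsOuterCentered.stronglyMeasurable {Ω : Type*} {mΩ : MeasurableSpace Ω} {μ : Measure Ω}
    {D V : ℕ → Ω → ℝ} {H : ℕ → MeasurableSpace Ω}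
    (h : IsOuterCentered D V H μ) (l : ℕ) : StronglyMeasurable (D l) :=
  (h.measurable_of_ne l (l + 1) (Nat.ne_of_lt (Nat.lt_succ_self l))).mono (h.le _)

theorem norm_exp_I_mul_ofReal (x : ℝ) : ‖Complex.exp (Complex.I * x)‖ = 1 := by
  rw [mul_comm]; exact Complex.norm_exp_ofReal_mul_I x

/-- Exchange the factors one by one. When the `r`-th is exchanged, all the others, whether still
`exp(iuD_j)` or already `exp(-u²V_j/2)`, are `H r`-measurable of modulus at most one. -/
theorem IsOuterCentered.norm_integral_prod_sub_le {D V : ℕ → Ω → ℝ} {H : ℕ → MeasurableSpace Ω}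
    (h : IsOuterCentered D V H μ) (u : ℝ) (k : ℕ) {α : ℝ}
    (hα : ∀ j, ∫ ω, ‖expRem (u * D j ω)‖ ∂μ + ∫ ω, expNegRem (u ^ 2 / 2 * V j ω) ∂μ ≤ α) :
    ‖∫ ω, ∏ j ∈ Finset.range k, Complex.exp (Complex.I * (u * D j ω : ℝ)) ∂μ
      - ∫ ω, ∏ j ∈ Finset.range k, (Real.exp (-(u ^ 2 / 2 * V j ω)) : ℂ) ∂μ‖ ≤ k * α := by
  set e : ℕ → Ω → ℂ := fun j ω => Complex.exp (Complex.I * (u * D j ω : ℝ)) with he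
  set g : ℕ → Ω → ℂ := fun j ω => (Real.exp (-(u ^ 2 / 2 * V j ω)) : ℂ) with hg
  have he1 : ∀ j ω, ‖e j ω‖ ≤ 1 := fun j ω => (norm_exp_I_mul_ofReal _).le
  have hg1 : ∀ j ω, ‖g j ω‖ ≤ 1 := fun j ω => by
    rw [hg, Complex.norm_real, Real.norm_of_nonneg (Real.exp_pos _).le]
    exact Real.exp_le_one_iff.2 (neg_nonpos.2 (mul_nonneg (by positivity) (h.nonneg j ω)))
  have hem : ∀ l j, l ≠ j → StronglyMeasurable[H j] (e l) := fun l j hlj =>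
    (show Continuous fun x : ℝ => Complex.exp (Complex.I * (u * x : ℝ)) by
      fun_prop).comp_stronglyMeasurable (h.measurable_of_ne l j hlj)
  have hgm : ∀ l j, StronglyMeasurable[H j] (g l) := fun l j =>
    (show Continuous fun x : ℝ => (Real.exp (-(u ^ 2 / 2 * x)) : ℂ) by
      fun_prop).comp_stronglyMeasurable (h.measurable_var l j)
  have hem' : ∀ l, StronglyMeasurable (e l) := fun l =>
    (show Continuous fun x : ℝ => Complex.exp (Complex.I * (u * x : ℝ)) by
      fun_prop).comp_stronglyMeasurable (h.stronglyMeasurable l)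
  have hgm' : ∀ l, StronglyMeasurable (g l) := fun l => (hgm l l).mono (h.le l)
  -- Hybrid products interpolating between all `g` (`r = 0`) and all `e` (`r = k`).
  set A : ℕ → Ω → ℂ := fun r ω => (∏ j ∈ Finset.range r, e j ω) * ∏ j ∈ Finset.Ico r k, g j ω
    with hA
  have hprod1 : ∀ (s t : Finset ℕ) ω, ‖(∏ j ∈ s, e j ω) * ∏ j ∈ t, g j ω‖ ≤ 1 := by
    intro s t ω
    rw [norm_mul, norm_prod, norm_prod]
    exact mul_le_one₀ (Finset.prod_le_one (fun _ _ => norm_nonneg _) fun j _ => he1 j ω)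
      (Finset.prod_nonneg fun _ _ => norm_nonneg _)
      (Finset.prod_le_one (fun _ _ => norm_nonneg _) fun j _ => hg1 j ω)
  have hAi : ∀ r, Integrable (A r) μ := fun r =>
    (integrable_const (1 : ℝ)).mono'
      ((Finset.stronglyMeasurable_fun_prod _ fun j _ => hem' j).mul
        (Finset.stronglyMeasurable_fun_prod _ fun j _ => hgm' j)).aestronglyMeasurable
      (.of_forall fun ω => hprod1 _ _ ω)
  have hstep : ∀ r ∈ Finset.range k, ‖∫ ω, A (r + 1) ω ∂μ - ∫ ω, A r ω ∂μ‖ ≤ α := by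
    intro r hr
    have hrk := Finset.mem_range.1 hr
    set W : Ω → ℂ := fun ω => (∏ j ∈ Finset.range r, e j ω) * ∏ j ∈ Finset.Ico (r + 1) k, g j ω
    have hWm : StronglyMeasurable[H r] W :=
      (Finset.stronglyMeasurable_fun_prod _ fun j hj =>
        hem j r (Finset.mem_range.1 hj).ne).mul
        (Finset.stronglyMeasurable_fun_prod _ fun j _ => hgm j r)
    rw [← integral_sub (hAi _) (hAi _)]
    have e1 : ∀ ω, A (r + 1) ω - A r ω = W ω * (e r ω - g r ω) := by
      intro ω
      simp only [hA, W]
      rw [Finset.prod_range_succ, Finset.prod_eq_prod_Ico_succ_bot hrk]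
      ring
    simp_rw [e1]
    exact (norm_integral_mul_exp_sub_le (h.le r) (h.memLp r) (h.integrable r)
      (h.measurable_var r r) (h.nonneg r) (h.condExp_eq_zero r) (h.condExp_sq r) hWm
      (fun ω => hprod1 _ _ ω) u).trans (hα r)
  have htel : ∫ ω, A k ω ∂μ - ∫ ω, A 0 ω ∂μ
      = ∑ r ∈ Finset.range k, (∫ ω, A (r + 1) ω ∂μ - ∫ ω, A r ω ∂μ) :=
    (Finset.sum_range_sub (fun r => ∫ ω, A r ω ∂μ) k).symm
  have h0 : ∀ ω, A 0 ω = ∏ j ∈ Finset.range k, g j ω := fun ω => by simp [hA]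
  have hk : ∀ ω, A k ω = ∏ j ∈ Finset.range k, e j ω := fun ω => by simp [hA]
  simp_rw [h0, hk] at htel
  rw [htel]
  refine (norm_sum_le_of_le _ hstep).trans ?_
  simp

theorem abs_exp_neg_sub_exp_neg_le {a b : ℝ} (ha : 0 ≤ a) (hb : 0 ≤ b) :
    |Real.exp (-a) - Real.exp (-b)| ≤ |a - b| := by
  wlog hab : a ≤ b generalizing a b
  · rw [abs_sub_comm, abs_sub_comm a]
    exact this hb ha (le_of_not_ge hab)
  have h1 : Real.exp (-b) ≤ Real.exp (-a) := Real.exp_le_exp.2 (by linarith)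
  have h2 : Real.exp (-b) = Real.exp (-a) * Real.exp (-(b - a)) := by
    rw [← Real.exp_add]; congr 1; ring
  have h3 := Real.add_one_le_exp (-(b - a))
  have h4 : Real.exp (-a) ≤ 1 := Real.exp_le_one_iff.2 (by linarith)
  have h5 := (Real.exp_pos (-a)).le
  rw [abs_of_nonneg (by linarith), abs_of_nonpos (by linarith), h2]
  nlinarith

/-- Central limit theorem for identically distributed outer-centered variables, in terms of
characteristic functions. -/
theorem IsOuterCentered.tendsto_integral_exp {D V : ℕ → Ω → ℝ} {H : ℕ → MeasurableSpace Ω}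
    (h : IsOuterCentered D V H μ) (hDid : ∀ j, IdentDistrib (D j) (D 0) μ μ)
    (hVid : ∀ j, IdentDistrib (V j) (V 0) μ μ) {v : ℝ} (hv : 0 ≤ v)
    (herg : Tendsto (fun N : ℕ => ∫ ω, |(∑ j ∈ Finset.range N, V j ω) / N - v| ∂μ) atTop (𝓝 0))
    {u : ℕ → ℝ} {K : ℕ → ℕ} {τ : ℝ} (hK : Tendsto K atTop atTop)
    (huK : Tendsto (fun n => u n ^ 2 * K n) atTop (𝓝 τ)) :
    Tendsto (fun n => ∫ ω, Complex.exp (Complex.I * (u n * ∑ j ∈ Finset.range (K n), D j ω : ℝ)) ∂μ)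
      atTop (𝓝 (Real.exp (-(τ * v / 2)) : ℂ)) := by
  -- Forced by `u²K → τ` together with `K → ∞`.
  have hu : Tendsto u atTop (𝓝 0) := by
    have h1 : Tendsto (fun n => (K n : ℝ)⁻¹) atTop (𝓝 0) :=
      tendsto_inv_atTop_zero.comp (tendsto_natCast_atTop_atTop.comp hK)
    have h2 := huK.mul h1
    rw [mul_zero] at h2
    have h3 : Tendsto (fun n => u n ^ 2) atTop (𝓝 0) := by
      refine h2.congr' ?_
      filter_upwards [hK.eventually_gt_atTop 0] with n hn
      field_simp
    have h4 := h3.sqrt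
    simp only [Real.sqrt_sq_eq_abs, Real.sqrt_zero] at h4
    exact (tendsto_zero_iff_abs_tendsto_zero u).2 h4
  set α : ℕ → ℝ := fun n => ∫ ω, ‖expRem (u n * D 0 ω)‖ ∂μ
    + ∫ ω, expNegRem (u n ^ 2 / 2 * V 0 ω) ∂μ with hαdef
  have hα : Tendsto (fun n => (K n : ℝ) * α n) atTop (𝓝 0) := by
    have := (tendsto_integral_expRem (h.memLp 0) hu huK).add
      (tendsto_integral_expNegRem (h.integrable 0) (h.nonneg 0) hu huK)
    rw [add_zero] at this
    exact this.congr fun n => by rw [hαdef]; ring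
  have hαj : ∀ n j, ∫ ω, ‖expRem (u n * D j ω)‖ ∂μ
      + ∫ ω, expNegRem (u n ^ 2 / 2 * V j ω) ∂μ ≤ α n := by
    intro n j
    have h1 := ((hDid j).comp (u := fun x => ‖expRem (u n * x)‖)
      (continuous_expRem.measurable.comp (measurable_const_mul (u n))).norm).integral_eq
    have h2 := ((hVid j).comp (u := fun x => expNegRem (u n ^ 2 / 2 * x))
      (continuous_expNegRem.measurable.comp (measurable_const_mul _))).integral_eq
    simp only [Function.comp_def] at h1 h2
    rw [h1, h2]
  have hdiff := fun n => h.norm_integral_prod_sub_le (u n) (K n) (hαj n)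
  -- Since `exp(-·)` is 1-Lipschitz on `[0, ∞)`, the `L¹` convergence of the averages of the `V j`
  -- lets `v` take their place.
  have hVsum : Tendsto (fun n => ∫ ω, Real.exp (-(u n ^ 2 / 2 * ∑ j ∈ Finset.range (K n), V j ω)) ∂μ)
      atTop (𝓝 (Real.exp (-(τ * v / 2)))) := by
    have h1 : Tendsto (fun n => Real.exp (-(u n ^ 2 * K n * v / 2))) atTop
        (𝓝 (Real.exp (-(τ * v / 2)))) :=
      (Real.continuous_exp.tendsto _).comp ((huK.mul_const v).div_const 2).neg
    have h2 : Tendsto (fun n => u n ^ 2 * K n / 2 *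
        ∫ ω, |(∑ j ∈ Finset.range (K n), V j ω) / K n - v| ∂μ) atTop (𝓝 0) := by
      simpa using (huK.div_const 2).mul (herg.comp hK)
    have h3 : Tendsto (fun n => ∫ ω, Real.exp (-(u n ^ 2 / 2 * ∑ j ∈ Finset.range (K n), V j ω)) ∂μ
        - Real.exp (-(u n ^ 2 * K n * v / 2))) atTop (𝓝 0) := by
      refine squeeze_zero_norm' ?_ h2
      filter_upwards [hK.eventually_gt_atTop 0] with n hn
      have hVs : Integrable (fun ω => ∑ j ∈ Finset.range (K n), V j ω) μ :=
        integrable_finsetSum _ fun j _ => h.integrable j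
      have hs0 : ∀ ω, 0 ≤ ∑ j ∈ Finset.range (K n), V j ω := fun ω =>
        Finset.sum_nonneg fun j _ => h.nonneg j ω
      have hei : Integrable
          (fun ω => Real.exp (-(u n ^ 2 / 2 * ∑ j ∈ Finset.range (K n), V j ω))) μ := by
        refine (integrable_const (1 : ℝ)).mono' (Real.continuous_exp.comp_aestronglyMeasurable
          (hVs.1.const_mul _).neg) (.of_forall fun ω => ?_)
        rw [Real.norm_of_nonneg (Real.exp_pos _).le]
        exact Real.exp_le_one_iff.2 (neg_nonpos.2 (mul_nonneg (by positivity) (hs0 ω)))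
      have : ∫ ω, Real.exp (-(u n ^ 2 / 2 * ∑ j ∈ Finset.range (K n), V j ω)) ∂μ
          - Real.exp (-(u n ^ 2 * K n * v / 2))
          = ∫ ω, (Real.exp (-(u n ^ 2 / 2 * ∑ j ∈ Finset.range (K n), V j ω))
            - Real.exp (-(u n ^ 2 * K n * v / 2))) ∂μ := by
        rw [integral_sub hei (integrable_const _)]; simp
      rw [this, ← integral_const_mul]
      refine norm_integral_le_of_norm_le
        (((hVs.div_const _).sub (integrable_const _)).abs.const_mul _) (.of_forall fun ω => ?_)
      refine (abs_exp_neg_sub_exp_neg_le (mul_nonneg (by positivity) (hs0 ω))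
        (by positivity)).trans (le_of_eq ?_)
      conv_rhs => rw [← abs_of_nonneg (show 0 ≤ u n ^ 2 * K n / 2 by positivity), ← abs_mul]
      congr 1
      field_simp
    simpa using h3.add h1
  have hVsumC : Tendsto (fun n => ∫ ω, ∏ j ∈ Finset.range (K n),
      (Real.exp (-(u n ^ 2 / 2 * V j ω)) : ℂ) ∂μ) atTop (𝓝 (Real.exp (-(τ * v / 2)) : ℂ)) := by
    have := (Complex.continuous_ofReal.tendsto _).comp hVsum
    refine this.congr fun n => ?_
    simp only [Function.comp_apply]
    rw [← integral_complex_ofReal]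
    congr 1
    ext ω
    rw [Finset.mul_sum, ← Finset.sum_neg_distrib, Real.exp_sum, Complex.ofReal_prod]
  have hdiff0 := squeeze_zero_norm hdiff hα
  have hsum := hdiff0.add hVsumC
  simp only [sub_add_cancel, zero_add] at hsum
  refine hsum.congr fun n => ?_
  congr 1
  ext ω
  rw [Finset.mul_sum, Complex.ofReal_sum, Finset.mul_sum, Complex.exp_sum]

end BlockCLT

/-! ### Markov property: one-sided and two-sided conditional independence. -/

section Markov

/-- Dynkin's π-λ argument. The total integral is a separate hypothesis, needed for complements
because `C` need not contain the whole space. -/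
theorem condExp_eq_zero_of_generateFrom {Ω : Type*} {m mΩ : MeasurableSpace Ω} {μ : Measure Ω}
    [IsProbabilityMeasure μ] (hm : m ≤ mΩ) {C : Set (Set Ω)}
    (hC : m = MeasurableSpace.generateFrom C) (hpi : IsPiSystem C) {Y : Ω → ℝ}
    (hY : Integrable Y μ) (h0 : ∫ ω, Y ω ∂μ = 0) (h : ∀ s ∈ C, ∫ ω in s, Y ω ∂μ = 0) :
    μ[Y | m] =ᵐ[μ] 0 := by
  refine (ae_eq_condExp_of_forall_setIntegral_eq (g := 0) hm hY
    (fun s _ _ => (integrable_zero _ _ _).integrableOn) (fun s hs _ => ?_)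
    aestronglyMeasurable_zero).symm
  simp only [Pi.zero_apply, integral_zero]
  symm
  clear * - hm hC hpi hY h0 h hs
  induction s, hs using MeasurableSpace.induction_on_inter hC hpi with
  | empty => simp
  | basic t ht => exact h t ht
  | compl t ht ih =>
    have := integral_add_compl (hm t ht) hY
    rw [ih, zero_add, h0] at this
    exact this
  | iUnion f hd hf ih =>
    rw [integral_iUnion (fun i => hm _ (hf i)) hd hY.integrableOn]
    simp [ih]

/-- The rectangles `s ∩ t` form a π-system generating the join. -/
theorem condExp_sup_eq_zero {Ω : Type*} {m₁ m₂ mΩ : MeasurableSpace Ω} {μ : Measure Ω}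
    [IsProbabilityMeasure μ] (h₁ : m₁ ≤ mΩ) (h₂ : m₂ ≤ mΩ) {Y : Ω → ℝ} (hY : Integrable Y μ)
    (h : ∀ s t, MeasurableSet[m₁] s → MeasurableSet[m₂] t → ∫ ω in s ∩ t, Y ω ∂μ = 0) :
    μ[Y | m₁ ⊔ m₂] =ᵐ[μ] 0 := by
  have h0 : ∫ ω, Y ω ∂μ = 0 := by
    simpa using h Set.univ Set.univ (@MeasurableSet.univ _ m₁) (@MeasurableSet.univ _ m₂)
  refine condExp_eq_zero_of_generateFrom (sup_le h₁ h₂)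
    (C := {r | ∃ s t, MeasurableSet[m₁] s ∧ MeasurableSet[m₂] t ∧ s ∩ t = r}) ?_ ?_ hY h0 ?_
  · refine le_antisymm (sup_le (fun s hs => ?_) fun t ht => ?_)
      (MeasurableSpace.generateFrom_le ?_)
    · exact MeasurableSpace.measurableSet_generateFrom
        ⟨s, Set.univ, hs, @MeasurableSet.univ _ m₂, Set.inter_univ s⟩
    · exact MeasurableSpace.measurableSet_generateFrom
        ⟨Set.univ, t, @MeasurableSet.univ _ m₁, ht, Set.univ_inter t⟩
    · rintro _ ⟨s, t, hs, ht, rfl⟩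
      exact @MeasurableSet.inter _ (m₁ ⊔ m₂) _ _ (le_sup_left (a := m₁) _ hs)
        (le_sup_right (a := m₁) _ ht)
  · rintro _ ⟨s, t, hs, ht, rfl⟩ _ ⟨s', t', hs', ht', rfl⟩ -
    exact ⟨s ∩ s', t ∩ t', @MeasurableSet.inter _ m₁ _ _ hs hs',
      @MeasurableSet.inter _ m₂ _ _ ht ht', Set.inter_inter_inter_comm _ _ _ _⟩
  · rintro _ ⟨s, t, hs, ht, rfl⟩
    exact h s t hs ht

variable {Ω S : Type*} [MeasurableSpace Ω] [MeasurableSpace S]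

/-- The sigma-algebra generated by `ξ_k`, `k ≥ n`. -/
abbrev future (ξ : ℤ → Ω → S) (n : ℤ) : MeasurableSpace Ω :=
  ⨆ (k : ℤ) (_ : n ≤ k), sigmaAt ξ k

/-- The sigma-algebra generated by `ξ_k`, `n ≤ k ≤ n + r`. -/
abbrev segment (ξ : ℤ → Ω → S) (n : ℤ) (r : ℕ) : MeasurableSpace Ω :=
  ⨆ (k : ℤ) (_ : n ≤ k ∧ k ≤ n + r), sigmaAt ξ k

variable {ξ : ℤ → Ω → S}

omit [MeasurableSpace Ω] in
theorem sigmaAt_le_past {k n : ℤ} (h : k ≤ n) : sigmaAt ξ k ≤ past ξ n := le_iSup₂_of_le k h le_rfl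

omit [MeasurableSpace Ω] in
theorem sigmaAt_le_future {k n : ℤ} (h : n ≤ k) : sigmaAt ξ k ≤ future ξ n :=
  le_iSup₂_of_le k h le_rfl

omit [MeasurableSpace Ω] in
theorem past_mono {k n : ℤ} (h : k ≤ n) : past ξ k ≤ past ξ n :=
  iSup₂_le fun _ hi => sigmaAt_le_past (hi.trans h)

omit [MeasurableSpace Ω] in
theorem future_anti {k n : ℤ} (h : n ≤ k) : future ξ k ≤ future ξ n :=
  iSup₂_le fun _ hi => sigmaAt_le_future (h.trans hi)

omit [MeasurableSpace Ω] in
theorem segment_le_past (n : ℤ) (r : ℕ) : segment ξ n r ≤ past ξ (n + r) :=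
  iSup₂_le fun _ hi => sigmaAt_le_past hi.2

omit [MeasurableSpace Ω] in
theorem segment_mono (n : ℤ) : Monotone (segment ξ n) := fun r s hrs =>
  iSup₂_le fun i hi => le_iSup₂_of_le i ⟨hi.1, hi.2.trans (by gcongr)⟩ le_rfl

omit [MeasurableSpace Ω] in
theorem segment_zero (n : ℤ) : segment ξ n 0 = sigmaAt ξ n := by
  refine le_antisymm (iSup₂_le fun i hi => ?_) (le_iSup₂_of_le n (by simp) le_rfl)
  obtain rfl : i = n := by have := hi.1; have := hi.2; push_cast at this; omega
  exact le_rfl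

omit [MeasurableSpace Ω] in
theorem segment_succ (n : ℤ) (r : ℕ) :
    segment ξ n (r + 1) = segment ξ n r ⊔ sigmaAt ξ (n + r + 1) := by
  refine le_antisymm (iSup₂_le fun i hi => ?_)
    (sup_le (segment_mono n (Nat.le_succ r)) (le_iSup₂_of_le (n + r + 1) ?_ le_rfl))
  · by_cases h : i ≤ n + r
    · exact le_sup_of_le_left (le_iSup₂_of_le i ⟨hi.1, h⟩ le_rfl)
    · obtain rfl : i = n + r + 1 := by have := hi.2; push_cast at this; omega
      exact le_sup_right
  · push_cast; omega

omit [MeasurableSpace Ω] in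
theorem iSup_segment (n : ℤ) : ⨆ r, segment ξ n r = future ξ n := by
  refine le_antisymm (iSup_le fun r => iSup₂_le fun i hi => sigmaAt_le_future hi.1)
    (iSup₂_le fun i hi => le_iSup_of_le (i - n).toNat (le_iSup₂_of_le i ⟨hi, ?_⟩ le_rfl))
  omega

theorem sigmaAt_le (hξ : ∀ n, Measurable (ξ n)) (n : ℤ) : sigmaAt ξ n ≤ ‹MeasurableSpace Ω› :=
  (hξ n).comap_le

theorem past_le (hξ : ∀ n, Measurable (ξ n)) (n : ℤ) : past ξ n ≤ ‹MeasurableSpace Ω› :=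
  iSup₂_le fun i _ => sigmaAt_le hξ i

theorem future_le (hξ : ∀ n, Measurable (ξ n)) (n : ℤ) : future ξ n ≤ ‹MeasurableSpace Ω› :=
  iSup₂_le fun i _ => sigmaAt_le hξ i

variable {μ : Measure Ω} [IsProbabilityMeasure μ]

omit [IsProbabilityMeasure μ] in
theorem setIntegral_inter_eq {s t : Set Ω} (hs : MeasurableSet s) (ht : MeasurableSet t)
    (Y : Ω → ℝ) : ∫ ω in s ∩ t, Y ω ∂μ
      = ∫ ω, t.indicator (fun _ => (1 : ℝ)) ω * (s.indicator (fun _ => (1 : ℝ)) ω * Y ω) ∂μ := by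
  rw [← integral_indicator (hs.inter ht)]
  congr 1
  ext ω
  by_cases h1 : ω ∈ s <;> by_cases h2 : ω ∈ t <;> simp [h1, h2]

omit [IsProbabilityMeasure μ] in
theorem integrable_indicator_mul {s : Set Ω} (hs : MeasurableSet s) {Y : Ω → ℝ}
    (hY : Integrable Y μ) : Integrable (fun ω => s.indicator (fun _ => (1 : ℝ)) ω * Y ω) μ := by
  refine hY.bdd_mul (c := 1) (measurable_const.indicator hs).aestronglyMeasurable
    (.of_forall fun ω => ?_)
  by_cases h : ω ∈ s <;> simp [h]

theorem ae_norm_condExp_indicator_le {Ω : Type*} {m mΩ : MeasurableSpace Ω} {μ : Measure Ω}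
    (s : Set Ω) :
    ∀ᵐ ω ∂μ, ‖(μ[s.indicator (fun _ => (1 : ℝ)) | m]) ω‖ ≤ 1 := by
  refine ae_bdd_abs_condExp_of_ae_bdd_abs (R := 1) (.of_forall fun ω => ?_)
  by_cases h : ω ∈ s <;> simp [h]

theorem integrable_condExp_indicator_mul {Ω : Type*} {m mΩ : MeasurableSpace Ω} {μ : Measure Ω}
    {s : Set Ω} {Y : Ω → ℝ} (hY : Integrable Y μ) :
    Integrable (fun ω => (μ[s.indicator (fun _ => (1 : ℝ)) | m]) ω * Y ω) μ :=
  hY.bdd_mul (c := 1) (integrable_condExp (m := m)).1 (ae_norm_condExp_indicator_le s)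

/-- Induction on the length of the observed future. The indicator of an event at time `n + r + 1`
may be projected on the past at `n + r`; the one-step Markov property turns the result into a
function of `ξ_{n+r}`, which already belongs to the shorter segment. -/
theorem IsStationaryMarkovChain.condExp_segment_eq_zero (hξ : IsStationaryMarkovChain ξ μ) {n : ℤ}
    {Y : Ω → ℝ} (hY : Integrable Y μ) (hYm : StronglyMeasurable[past ξ n] Y)
    (hY0 : μ[Y | sigmaAt ξ n] =ᵐ[μ] 0) (r : ℕ) : μ[Y | segment ξ n r] =ᵐ[μ] 0 := by
  induction r with
  | zero => rwa [segment_zero]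
  | succ r ih =>
    have hseg : segment ξ n r ≤ ‹MeasurableSpace Ω› :=
      (segment_le_past n r).trans (past_le hξ.measurable _)
    rw [segment_succ]
    refine condExp_sup_eq_zero hseg (sigmaAt_le hξ.measurable _) hY ?_
    rintro s _ hs ⟨A, hA, rfl⟩
    have hA' : MeasurableSet (ξ (n + r + 1) ⁻¹' A) := hξ.measurable _ hA
    have hsY := integrable_indicator_mul (hseg s hs) hY
    have hsm : StronglyMeasurable[segment ξ n r] (s.indicator fun _ => (1 : ℝ)) :=
      stronglyMeasurable_const.indicator hs
    have hsYm : StronglyMeasurable[past ξ (n + r)]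
        fun ω => s.indicator (fun _ => (1 : ℝ)) ω * Y ω :=
      (hsm.mono (segment_le_past n r)).mul (hYm.mono (past_mono (by omega)))
    rw [setIntegral_inter_eq (hseg s hs) hA',
      ← integral_condExp_mul (past_le hξ.measurable (n + r)) hsYm
        ((integrable_const 1).indicator hA') (integrable_indicator_mul hA' hsY)]
    have e : ∫ ω, (μ[(ξ (n + r + 1) ⁻¹' A).indicator (fun _ => (1 : ℝ)) | past ξ (n + r)]) ω
          * (s.indicator (fun _ => (1 : ℝ)) ω * Y ω) ∂μ
        = ∫ ω, Y ω * ((μ[(ξ (n + r + 1) ⁻¹' A).indicator (fun _ => (1 : ℝ)) | sigmaAt ξ (n + r)]) ω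
          * s.indicator (fun _ => (1 : ℝ)) ω) ∂μ := by
      refine integral_congr_ae ?_
      filter_upwards [hξ.markov (n + r) A hA] with ω h
      rw [h]
      ring
    rw [e]
    refine integral_mul_eq_zero_of_condExp hseg hY ih ?_ ?_
    · exact (stronglyMeasurable_condExp.mono
        (le_iSup₂_of_le (f := fun k (_ : n ≤ k ∧ k ≤ n + r) => sigmaAt ξ k) (n + r)
          ⟨by omega, le_rfl⟩ le_rfl)).mul hsm
    · exact (integrable_condExp_indicator_mul hsY).congr (.of_forall fun ω => by ring)

/-- Markov property: given the present, the past and the future are conditionally independent. -/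
theorem IsStationaryMarkovChain.condExp_future (hξ : IsStationaryMarkovChain ξ μ) {n : ℤ}
    {Y : Ω → ℝ} (hY : Integrable Y μ) (hYm : StronglyMeasurable[past ξ n] Y) :
    μ[Y | future ξ n] =ᵐ[μ] μ[Y | sigmaAt ξ n] := by
  have hσ := sigmaAt_le hξ.measurable n
  have hF := future_le hξ.measurable n
  set Z : Ω → ℝ := Y - μ[Y | sigmaAt ξ n] with hZ
  have hZi : Integrable Z μ := hY.sub integrable_condExp
  have hZm : StronglyMeasurable[past ξ n] Z :=
    hYm.sub (stronglyMeasurable_condExp.mono (sigmaAt_le_past le_rfl))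
  have hZ0 : μ[Z | sigmaAt ξ n] =ᵐ[μ] 0 := by
    refine (condExp_sub hY integrable_condExp _).trans ?_
    rw [condExp_of_stronglyMeasurable hσ stronglyMeasurable_condExp integrable_condExp, sub_self]
  have hZF : μ[Z | future ξ n] =ᵐ[μ] 0 := by
    have hseg : ∀ r, segment ξ n r ≤ ‹MeasurableSpace Ω› := fun r =>
      (segment_le_past n r).trans (past_le hξ.measurable _)
    -- The segments increase with `r`, so their union is a π-system, and it generates the whole
    -- future.
    refine condExp_eq_zero_of_generateFrom hF
      (C := ⋃ r, {s | MeasurableSet[segment ξ n r] s}) ?_ ?_ hZi ?_ ?_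
    · exact ((MeasurableSpace.generateFrom_iUnion_measurableSet (segment ξ n)).trans
        (iSup_segment n)).symm
    · exact isPiSystem_iUnion_of_monotone _ (fun r => @MeasurableSpace.isPiSystem_measurableSet _
        (segment ξ n r)) fun r s hrs t ht => segment_mono n hrs t ht
    · rw [← integral_condExp hσ]
      exact integral_eq_zero_of_ae hZ0
    · intro s hs
      obtain ⟨r, hr⟩ := Set.mem_iUnion.1 hs
      rw [← setIntegral_condExp (hseg r) hZi hr]
      refine setIntegral_eq_zero_of_ae_eq_zero ?_
      filter_upwards [hξ.condExp_segment_eq_zero hZi hZm hZ0 r] with ω h _ using h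
  have h := condExp_sub (m := future ξ n) hY (integrable_condExp (m := sigmaAt ξ n) (f := Y) (μ := μ))
  rw [condExp_of_stronglyMeasurable (f := μ[Y | sigmaAt ξ n]) hF
    (stronglyMeasurable_condExp.mono (sigmaAt_le_future le_rfl)) integrable_condExp] at h
  filter_upwards [h, hZF] with ω h1 h2
  rw [hZ] at h2
  rw [h2] at h1
  simp only [Pi.zero_apply, Pi.sub_apply] at h1
  linarith

/-- Conditional expectations are self-adjoint: the reduction of a past variable `Y` to the present
is transferred to the future event `q`. -/
theorem IsStationaryMarkovChain.integral_indicator_mul (hξ : IsStationaryMarkovChain ξ μ) {n : ℤ}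
    {Y : Ω → ℝ} (hY : Integrable Y μ) (hYm : StronglyMeasurable[past ξ n] Y) {q : Set Ω}
    (hq : MeasurableSet[future ξ n] q) :
    ∫ ω, q.indicator (fun _ => (1 : ℝ)) ω * Y ω ∂μ
      = ∫ ω, (μ[q.indicator (fun _ => (1 : ℝ)) | sigmaAt ξ n]) ω * Y ω ∂μ := by
  have hσ := sigmaAt_le hξ.measurable n
  have hF := future_le hξ.measurable n
  have hq' := hF q hq
  have h1 : Integrable (q.indicator fun _ => (1 : ℝ)) μ := (integrable_const 1).indicator hq'
  calc ∫ ω, q.indicator (fun _ => (1 : ℝ)) ω * Y ω ∂μ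
      = ∫ ω, Y ω * q.indicator (fun _ => (1 : ℝ)) ω ∂μ := by simp_rw [mul_comm]
    _ = ∫ ω, (μ[Y | future ξ n]) ω * q.indicator (fun _ => (1 : ℝ)) ω ∂μ :=
        (integral_condExp_mul hF (stronglyMeasurable_const.indicator hq) hY
          ((integrable_indicator_mul hq' hY).congr (.of_forall fun ω => mul_comm _ _))).symm
    _ = ∫ ω, q.indicator (fun _ => (1 : ℝ)) ω * (μ[Y | sigmaAt ξ n]) ω ∂μ := by
        refine integral_congr_ae ?_
        filter_upwards [hξ.condExp_future hY hYm] with ω h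
        rw [h, mul_comm]
    _ = ∫ ω, (μ[q.indicator (fun _ => (1 : ℝ)) | sigmaAt ξ n]) ω * (μ[Y | sigmaAt ξ n]) ω ∂μ :=
        (integral_condExp_mul hσ stronglyMeasurable_condExp h1
          (integrable_indicator_mul hq' integrable_condExp)).symm
    _ = ∫ ω, (μ[Y | sigmaAt ξ n]) ω * (μ[q.indicator (fun _ => (1 : ℝ)) | sigmaAt ξ n]) ω ∂μ := by
        simp_rw [mul_comm]
    _ = ∫ ω, Y ω * (μ[q.indicator (fun _ => (1 : ℝ)) | sigmaAt ξ n]) ω ∂μ :=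
        integral_condExp_mul hσ stronglyMeasurable_condExp hY
          ((integrable_condExp_indicator_mul hY).congr (.of_forall fun ω => mul_comm _ _))
    _ = _ := by simp_rw [mul_comm]

/-- Two-sided Markov property: a variable determined by the chain between times `a` and `b`
depends on the chain outside `(a, b)` only through `ξ_a` and `ξ_b`. -/
theorem IsStationaryMarkovChain.condExp_past_sup_future (hξ : IsStationaryMarkovChain ξ μ)
    {a b : ℤ} (hab : a ≤ b) {Z : Ω → ℝ} (hZ : Integrable Z μ)
    (hZa : StronglyMeasurable[future ξ a] Z) (hZb : StronglyMeasurable[past ξ b] Z) :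
    μ[Z | past ξ a ⊔ future ξ b] =ᵐ[μ] μ[Z | sigmaAt ξ a ⊔ sigmaAt ξ b] := by
  have hPa := past_le hξ.measurable a
  have hFa := future_le hξ.measurable a
  have hFb := future_le hξ.measurable b
  have hG : sigmaAt ξ a ⊔ sigmaAt ξ b ≤ ‹MeasurableSpace Ω› :=
    sup_le (sigmaAt_le hξ.measurable a) (sigmaAt_le hξ.measurable b)
  have hGH : sigmaAt ξ a ⊔ sigmaAt ξ b ≤ past ξ a ⊔ future ξ b :=
    sup_le_sup (sigmaAt_le_past le_rfl) (sigmaAt_le_future le_rfl)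
  set Y : Ω → ℝ := Z - μ[Z | sigmaAt ξ a ⊔ sigmaAt ξ b] with hY
  have hYi : Integrable Y μ := hZ.sub integrable_condExp
  have hYa : StronglyMeasurable[future ξ a] Y := hZa.sub (stronglyMeasurable_condExp.mono
    (sup_le (sigmaAt_le_future le_rfl) (sigmaAt_le_future hab)))
  have hYb : StronglyMeasurable[past ξ b] Y := hZb.sub (stronglyMeasurable_condExp.mono
    (sup_le (sigmaAt_le_past hab) (sigmaAt_le_past le_rfl)))
  have hY0 : μ[Y | sigmaAt ξ a ⊔ sigmaAt ξ b] =ᵐ[μ] 0 := by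
    refine (condExp_sub hZ integrable_condExp _).trans ?_
    rw [condExp_of_stronglyMeasurable hG stronglyMeasurable_condExp integrable_condExp, sub_self]
  have hYH : μ[Y | past ξ a ⊔ future ξ b] =ᵐ[μ] 0 := by
    -- On a rectangle, the indicator of `p` is reduced to a function of `ξ_a` and then that of `q`
    -- to a function of `ξ_b`. Their product is measurable for the two end states, against which `Y`
    -- is centered.
    refine condExp_sup_eq_zero hPa hFb hYi fun p q hp hq => ?_
    have hp' := hPa p hp
    have hq' := hFb q hq
    have h1 : Integrable (p.indicator fun _ => (1 : ℝ)) μ := (integrable_const 1).indicator hp'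
    have hqY := integrable_indicator_mul hq' hYi
    have huY : Integrable
        (fun ω => (μ[p.indicator (fun _ => (1 : ℝ)) | sigmaAt ξ a]) ω * Y ω) μ :=
      integrable_condExp_indicator_mul hYi
    calc ∫ ω in p ∩ q, Y ω ∂μ
        = ∫ ω, p.indicator (fun _ => (1 : ℝ)) ω * (q.indicator (fun _ => (1 : ℝ)) ω * Y ω) ∂μ := by
          rw [Set.inter_comm, setIntegral_inter_eq hq' hp']
      _ = ∫ ω, (μ[p.indicator (fun _ => (1 : ℝ)) | future ξ a]) ω
            * (q.indicator (fun _ => (1 : ℝ)) ω * Y ω) ∂μ :=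
          (integral_condExp_mul hFa ((stronglyMeasurable_const.indicator
            (future_anti hab q hq)).mul hYa) h1 (integrable_indicator_mul hp' hqY)).symm
      _ = ∫ ω, q.indicator (fun _ => (1 : ℝ)) ω
            * ((μ[p.indicator (fun _ => (1 : ℝ)) | sigmaAt ξ a]) ω * Y ω) ∂μ := by
          refine integral_congr_ae ?_
          filter_upwards [hξ.condExp_future h1 (stronglyMeasurable_const.indicator hp)] with ω h
          rw [h]
          ring
      _ = ∫ ω, (μ[q.indicator (fun _ => (1 : ℝ)) | sigmaAt ξ b]) ω
            * ((μ[p.indicator (fun _ => (1 : ℝ)) | sigmaAt ξ a]) ω * Y ω) ∂μ :=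
          hξ.integral_indicator_mul huY
            ((stronglyMeasurable_condExp.mono (sigmaAt_le_past hab)).mul hYb) hq
      _ = ∫ ω, Y ω * ((μ[q.indicator (fun _ => (1 : ℝ)) | sigmaAt ξ b]) ω
            * (μ[p.indicator (fun _ => (1 : ℝ)) | sigmaAt ξ a]) ω) ∂μ := by
          congr 1
          ext ω
          ring
      _ = 0 := integral_mul_eq_zero_of_condExp hG hYi hY0
          ((stronglyMeasurable_condExp.mono le_sup_right).mul
            (stronglyMeasurable_condExp.mono le_sup_left))
          ((integrable_condExp_indicator_mul (m := sigmaAt ξ b) (s := q) huY).congr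
            (.of_forall fun ω => by ring))
  have h := condExp_sub (m := past ξ a ⊔ future ξ b) hZ
    (integrable_condExp (m := sigmaAt ξ a ⊔ sigmaAt ξ b) (f := Z) (μ := μ))
  rw [condExp_of_stronglyMeasurable (f := μ[Z | sigmaAt ξ a ⊔ sigmaAt ξ b]) (sup_le hPa hFb)
    (stronglyMeasurable_condExp.mono hGH) integrable_condExp] at h
  filter_upwards [h, hYH] with ω h1 h2
  rw [hY] at h2
  rw [h2] at h1
  simp only [Pi.zero_apply, Pi.sub_apply] at h1
  linarith

end Markov

/-! ### Path space: shifts of blocks and of sigma-algebras. -/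

section Canonical

variable {S : Type*} [MeasurableSpace S]

/-- The coordinate process on the two-sided sequence space. -/
def coord (n : ℤ) (x : ℤ → S) : S := x n

omit [MeasurableSpace S] in
theorem iterate_shift_apply (j : ℕ) (x : ℤ → S) (n : ℤ) : shift^[j] x n = x (n + j) := by
  induction j generalizing x n with
  | zero => simp
  | succ j ih =>
    rw [Function.iterate_succ_apply, ih, shift]
    congr 1
    push_cast
    ring

omit [MeasurableSpace S] in
theorem coord_comp_iterate_shift (k : ℤ) (j : ℕ) :
    (coord k : (ℤ → S) → S) ∘ shift^[j] = coord (k + j) :=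
  funext fun x => iterate_shift_apply j x k

omit [MeasurableSpace S] in
theorem obs_coord_comp_iterate_shift (f : S → ℝ) (k : ℤ) (j : ℕ) :
    obs f coord k ∘ shift^[j] = obs f coord (k + j) :=
  funext fun x => congrArg f (iterate_shift_apply j x k)

theorem comap_iterate_shift_sigmaAt (k : ℤ) (j : ℕ) :
    (sigmaAt (coord (S := S)) k).comap shift^[j] = sigmaAt coord (k + j) := by
  rw [sigmaAt, MeasurableSpace.comap_comp, coord_comp_iterate_shift]

theorem comap_iterate_shift_past_le (k : ℤ) (j : ℕ) :
    (past (coord (S := S)) k).comap shift^[j] ≤ past coord (k + j) := by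
  simp only [past, MeasurableSpace.comap_iSup, comap_iterate_shift_sigmaAt]
  exact iSup₂_le fun i hi => sigmaAt_le_past (by omega)

theorem comap_iterate_shift_future_le (k : ℤ) (j : ℕ) :
    (future (coord (S := S)) k).comap shift^[j] ≤ future coord (k + j) := by
  simp only [future, MeasurableSpace.comap_iSup, comap_iterate_shift_sigmaAt]
  exact iSup₂_le fun i hi => sigmaAt_le_future (by omega)

theorem stronglyMeasurable_comp_comap {α β : Type*} {m : MeasurableSpace β} {φ : α → β}
    {g : β → ℝ} (hg : StronglyMeasurable[m] g) : StronglyMeasurable[m.comap φ] (g ∘ φ) :=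
  hg.comp_measurable (comap_measurable φ)

theorem lpNorm_comp_measurePreserving {α β : Type*} {mα : MeasurableSpace α}
    {mβ : MeasurableSpace β} {μ : Measure α} {ν : Measure β} {φ : α → β}
    (hφ : MeasurePreserving φ μ ν) {g : β → ℝ} (hg : AEStronglyMeasurable g ν) :
    lpNorm (g ∘ φ) 2 μ = lpNorm g 2 ν := by
  rw [← toReal_eLpNorm hg, ← toReal_eLpNorm (hg.comp_measurePreserving hφ),
    eLpNorm_comp_measurePreserving hg hφ]

theorem lpNorm_two_congr_ae {Ω : Type*} {mΩ : MeasurableSpace Ω} {μ : Measure Ω} {Z W : Ω → ℝ}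
    (hZ : AEStronglyMeasurable Z μ) (h : Z =ᵐ[μ] W) : lpNorm Z 2 μ = lpNorm W 2 μ := by
  rw [← toReal_eLpNorm hZ, ← toReal_eLpNorm (hZ.congr h), eLpNorm_congr_ae h]

theorem obs_stronglyMeasurable {Ω : Type*} {f : S → ℝ} (hf : Measurable f) (ξ : ℤ → Ω → S)
    (k : ℤ) : StronglyMeasurable[sigmaAt ξ k] (obs f ξ k) :=
  (hf.comp (comap_measurable (ξ k))).stronglyMeasurable

/-- The `L²` norm of `E(X_0 | ξ_{-k}, ξ_k)`. -/
noncomputable def twoSidedNorm (f : S → ℝ) (P : Measure (ℤ → S)) (k : ℕ) : ℝ :=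
  lpNorm (P[obs f coord 0 | sigmaAt coord (-(k : ℤ)) ⊔ sigmaAt coord (k : ℤ)]) 2 P

theorem twoSidedNorm_nonneg (f : S → ℝ) (P : Measure (ℤ → S)) (k : ℕ) :
    0 ≤ twoSidedNorm f P k := lpNorm_nonneg

omit [MeasurableSpace S] in
theorem partialSum_eq_sum_range {Ω : Type*} (f : S → ℝ) (ξ : ℤ → Ω → S) (n : ℕ) (ω : Ω) :
    partialSum f ξ n ω = ∑ i ∈ Finset.range n, obs f ξ ((i + 1 : ℕ) : ℤ) ω := by
  rw [partialSum, Finset.sum_bij (i := fun a (_ : a ∈ Finset.Icc 1 n) => a - 1)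
    (t := Finset.range n) (g := fun i => obs f ξ ((i + 1 : ℕ) : ℤ) ω)]
  · intro a ha
    have := Finset.mem_Icc.1 ha
    exact Finset.mem_range.2 (by omega)
  · intro a ha b hb h
    have := Finset.mem_Icc.1 ha
    have := Finset.mem_Icc.1 hb
    omega
  · intro b hb
    have := Finset.mem_range.1 hb
    exact ⟨b + 1, Finset.mem_Icc.2 (by omega), by omega⟩
  · intro a ha
    have := Finset.mem_Icc.1 ha
    rw [Nat.sub_add_cancel this.1]

omit [MeasurableSpace S] in
theorem partialSum_add (f : S → ℝ) (a b : ℕ) (x : ℤ → S) :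
    partialSum f coord (a + b) x = partialSum f coord a x + partialSum f coord b (shift^[a] x) := by
  simp only [partialSum_eq_sum_range]
  rw [Finset.sum_range_add]
  congr 1
  refine Finset.sum_congr rfl fun i _ => ?_
  have := congrFun (obs_coord_comp_iterate_shift f ((i + 1 : ℕ) : ℤ) a) x
  rw [Function.comp_apply] at this
  rw [this]
  congr 1
  push_cast
  ring

omit [MeasurableSpace S] in
theorem partialSum_block (f : S → ℝ) (m k : ℕ) (x : ℤ → S) :
    partialSum f coord (m * k) x
      = ∑ l ∈ Finset.range k, partialSum f coord m (shift^[m * l] x) := by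
  induction k with
  | zero => simp [partialSum]
  | succ k ih => rw [Nat.mul_succ, partialSum_add, ih, Finset.sum_range_succ]

/-- A square-summable sequence has partial sums `o(√n)`: Cauchy–Schwarz on a tail of small square
sum, while the initial part is a fixed constant. -/
theorem tendsto_sq_sum_div {b : ℕ → ℝ} (hs : Summable fun k => b k ^ 2) :
    Tendsto (fun n : ℕ => (∑ j ∈ Finset.range n, b j) ^ 2 / n) atTop (𝓝 0) := by
  refine Metric.tendsto_atTop.2 fun ε hε => ?_
  obtain ⟨N, hN⟩ := (((tendsto_sum_nat_add fun k => b k ^ 2).eventually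
    (gt_mem_nhds (show (0 : ℝ) < ε / 4 by positivity)))).exists
  have hlim : Tendsto (fun n : ℕ => 2 * (∑ j ∈ Finset.range N, b j) ^ 2 / (n : ℝ)) atTop (𝓝 0) :=
    tendsto_const_div_atTop_nhds_zero_nat _
  obtain ⟨n₀, hn₀⟩ := eventually_atTop.1
    (hlim.eventually (gt_mem_nhds (show (0 : ℝ) < ε / 2 by positivity)))
  refine ⟨max (N + 1) n₀, fun n hn => ?_⟩
  have h1 : N + 1 ≤ n := (le_max_left _ _).trans hn
  have h2 := hn₀ n ((le_max_right _ _).trans hn)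
  have hnpos : (0 : ℝ) < n := by exact_mod_cast (by omega : 0 < n)
  rw [Real.dist_0_eq_abs, abs_of_nonneg (by positivity)]
  obtain ⟨r, rfl⟩ := Nat.exists_eq_add_of_le ((Nat.le_succ N).trans h1)
  have hcs : (∑ j ∈ Finset.range r, b (N + j)) ^ 2 ≤ r * (ε / 4) := by
    have h3 := sq_sum_le_card_mul_sum_sq (s := Finset.range r) (f := fun j => b (N + j))
    rw [Finset.card_range] at h3
    refine h3.trans (mul_le_mul_of_nonneg_left ?_ (Nat.cast_nonneg r))
    have h4 : Summable fun k => b (k + N) ^ 2 := (summable_nat_add_iff N).2 hs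
    have h5 := h4.sum_le_tsum (Finset.range r) fun _ _ => sq_nonneg _
    simp only [add_comm _ N] at h5 hN
    exact h5.trans hN.le
  rw [Finset.sum_range_add]
  have h6 : (∑ j ∈ Finset.range N, b j + ∑ j ∈ Finset.range r, b (N + j)) ^ 2
      ≤ 2 * (∑ j ∈ Finset.range N, b j) ^ 2 + 2 * (∑ j ∈ Finset.range r, b (N + j)) ^ 2 := by
    nlinarith [sq_nonneg (∑ j ∈ Finset.range N, b j - ∑ j ∈ Finset.range r, b (N + j))]
  have h7 : (r : ℝ) ≤ ((N + r : ℕ) : ℝ) := by exact_mod_cast Nat.le_add_left r N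
  rw [div_lt_iff₀ hnpos] at h2 ⊢
  nlinarith

/-! ### Covariances, growth of the variance, and size of `E(S_m | ξ_0, ξ_m)`. -/

variable {P : Measure (ℤ → S)} [IsProbabilityMeasure P] {f : S → ℝ}

omit [IsProbabilityMeasure P] in
theorem pathLaw_coord : pathLaw coord P = P := Measure.map_id

omit [IsProbabilityMeasure P] in
theorem IsStationaryMarkovChain.measurePreserving_shift (hξ : IsStationaryMarkovChain coord P)
    (j : ℕ) : MeasurePreserving shift^[j] P P := by
  have := hξ.stationary
  rw [pathLaw_coord] at this
  exact this.iterate j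

omit [IsProbabilityMeasure P] in
theorem memLp_obs (hξ : IsStationaryMarkovChain coord P) (hf : MemL20 f (P.map (coord 0)))
    (j : ℕ) : MemLp (obs f coord (j : ℤ)) 2 P := by
  have h0 : MemLp (obs f coord 0) 2 P :=
    hf.memLp.comp_measurePreserving ((hξ.measurable 0).measurePreserving P)
  have := h0.comp_measurePreserving (hξ.measurePreserving_shift j)
  rwa [obs_coord_comp_iterate_shift, zero_add] at this

omit [IsProbabilityMeasure P] in
theorem memLp_partialSum (hξ : IsStationaryMarkovChain coord P)
    (hf : MemL20 f (P.map (coord 0))) (n : ℕ) : MemLp (partialSum f coord n) 2 P := by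
  have : partialSum f coord n = fun x => ∑ i ∈ Finset.Icc 1 n, obs f coord (i : ℤ) x := rfl
  rw [this]
  exact memLp_finsetSum _ fun i _ => memLp_obs hξ hf i

omit [IsProbabilityMeasure P] in
theorem integral_obs_mul_obs (hξ : IsStationaryMarkovChain coord P)
    (hf : MemL20 f (P.map (coord 0))) (i j : ℕ) :
    ∫ x, obs f coord (i : ℤ) x * obs f coord ((i + j : ℕ) : ℤ) x ∂P
      = ∫ x, obs f coord 0 x * obs f coord (j : ℤ) x ∂P := by
  rw [← integral_comp_measurePreserving (hξ.measurePreserving_shift i)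
    (g := fun x => obs f coord 0 x * obs f coord (j : ℤ) x)
    ((memLp_obs hξ hf 0).1.mul (memLp_obs hξ hf j).1)]
  congr 1
  ext x
  have h1 := congrFun (obs_coord_comp_iterate_shift f 0 i) x
  have h2 := congrFun (obs_coord_comp_iterate_shift f j i) x
  simp only [Function.comp_apply] at h1 h2
  rw [h1, h2, zero_add, Nat.cast_add, add_comm (i : ℤ)]

theorem lpNorm_condExp_comp_shift (hξ : IsStationaryMarkovChain coord P)
    {m m' : MeasurableSpace (ℤ → S)} (hm : m ≤ MeasurableSpace.pi) {g : (ℤ → S) → ℝ}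
    (hg : Integrable g P) (j : ℕ) (hm' : m.comap shift^[j] = m') :
    lpNorm (P[g ∘ shift^[j] | m']) 2 P = lpNorm (P[g | m]) 2 P := by
  have h := condExp_comp_measurePreserving (hξ.measurePreserving_shift j) hm hg
  rw [hm'] at h
  rw [lpNorm_two_congr_ae integrable_condExp.1 h,
    lpNorm_comp_measurePreserving (hξ.measurePreserving_shift j) integrable_condExp.1]

/-- Given `ξ_p` the two factors are conditionally independent, so each may be replaced by its
conditional expectation given `ξ_p`. Stationarity moves the second to `E(X_0 | ξ_{-q})`, and
conditioning on two states instead of one only increases the norms. -/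
theorem abs_integral_obs_mul_obs_le (hξ : IsStationaryMarkovChain coord P)
    (hf : MemL20 f (P.map (coord 0))) (p q : ℕ) :
    |∫ x, obs f coord 0 x * obs f coord ((p + q : ℕ) : ℤ) x ∂P|
      ≤ twoSidedNorm f P p * twoSidedNorm f P q := by
  have hle := sigmaAt_le hξ.measurable
  have h0 : MemLp (obs f coord 0) 2 P := memLp_obs hξ hf 0
  have hpq := memLp_obs hξ hf (p + q)
  have hm := fun k => obs_stronglyMeasurable hf.measurable (coord (S := S)) k
  have e : ∫ x, obs f coord 0 x * obs f coord ((p + q : ℕ) : ℤ) x ∂P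
      = ∫ x, (P[obs f coord ((p + q : ℕ) : ℤ) | sigmaAt coord (p : ℤ)]) x
          * (P[obs f coord 0 | sigmaAt coord (p : ℤ)]) x ∂P := by
    rw [integral_condExp_mul (hle p) stronglyMeasurable_condExp (hpq.integrable (by simp))
        (hpq.integrable_mul (h0.condExp (by simp))),
      ← integral_condExp_mul (future_le hξ.measurable p)
        ((hm ((p + q : ℕ) : ℤ)).mono (sigmaAt_le_future (by push_cast; omega)))
        (h0.integrable (by simp)) (h0.integrable_mul hpq)]
    refine integral_congr_ae ?_
    filter_upwards [hξ.condExp_future (n := p) (h0.integrable (by simp))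
      ((hm 0).mono (sigmaAt_le_past (by omega)))] with x hx
    rw [hx, mul_comm]
  rw [e, mul_comm (twoSidedNorm f P p)]
  refine (abs_integral_mul_le (hpq.condExp (by simp)) (h0.condExp (by simp))).trans
    (mul_le_mul ?_ ?_ lpNorm_nonneg lpNorm_nonneg)
  · have h1 := lpNorm_condExp_comp_shift hξ (m := sigmaAt coord (-(q : ℤ)))
      (m' := sigmaAt coord (p : ℤ)) (hle _) (h0.integrable (by simp)) (p + q)
      (by rw [comap_iterate_shift_sigmaAt]; congr 1; push_cast; ring)
    rw [obs_coord_comp_iterate_shift, zero_add] at h1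
    rw [h1]
    exact lpNorm_condExp_mono le_sup_left (sup_le (hle _) (hle _)) h0
  · exact lpNorm_condExp_mono le_sup_right (sup_le (hle _) (hle _)) h0

theorem summable_integral_obs_mul_obs (hξ : IsStationaryMarkovChain coord P)
    (hf : MemL20 f (P.map (coord 0))) (hA : Summable fun k => twoSidedNorm f P k ^ 2) :
    Summable fun k : ℕ => ∫ x, obs f coord 0 x * obs f coord (k : ℤ) x ∂P := by
  have hA' : Summable fun k => twoSidedNorm f P (k + 1) ^ 2 := (summable_nat_add_iff 1).2 hA
  set c : ℕ → ℝ := fun k => ∫ x, obs f coord 0 x * obs f coord (k : ℤ) x ∂P with hc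
  have heven : Summable fun k => c (2 * k) := by
    refine hA.of_norm_bounded fun k => ?_
    have := abs_integral_obs_mul_obs_le hξ hf k k
    rw [two_mul, Real.norm_eq_abs, pow_two]
    exact this
  have hodd : Summable fun k => c (2 * k + 1) := by
    refine (hA.add hA').of_norm_bounded fun k => ?_
    -- An odd lag is split as `k + (k + 1)`, and `2ab ≤ a² + b²` brings back squares.
    have := abs_integral_obs_mul_obs_le hξ hf k (k + 1)
    rw [two_mul, Real.norm_eq_abs, add_assoc]
    refine this.trans ?_
    nlinarith [sq_nonneg (twoSidedNorm f P k - twoSidedNorm f P (k + 1)),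
      sq_nonneg (twoSidedNorm f P k), sq_nonneg (twoSidedNorm f P (k + 1))]
  exact (heven.hasSum.even_add_odd hodd.hasSum).summable

omit [IsProbabilityMeasure P] in
-- The increments of `E(S_n²)` are partial sums of the series for `σ²`; in this form the limit of
-- `E(S_n²)/n` is a Cesàro mean.
theorem integral_partialSum_sq (hξ : IsStationaryMarkovChain coord P)
    (hf : MemL20 f (P.map (coord 0))) (n : ℕ) :
    ∫ x, partialSum f coord n x ^ 2 ∂P = ∑ j ∈ Finset.range n,
      (∫ x, obs f coord 0 x ^ 2 ∂P + 2 * ∑ k ∈ Finset.range j,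
        ∫ x, obs f coord 0 x * obs f coord ((k + 1 : ℕ) : ℤ) x ∂P) := by
  induction n with
  | zero => simp [partialSum]
  | succ n ih =>
    rw [Finset.sum_range_succ, ← ih]
    have hS := memLp_partialSum hξ hf n
    have hX := memLp_obs hξ hf (n + 1)
    have e : ∀ x, partialSum f coord (n + 1) x ^ 2 = partialSum f coord n x ^ 2
        + obs f coord ((n + 1 : ℕ) : ℤ) x ^ 2
        + 2 * (partialSum f coord n x * obs f coord ((n + 1 : ℕ) : ℤ) x) := by
      intro x
      have : partialSum f coord (n + 1) x
          = partialSum f coord n x + obs f coord ((n + 1 : ℕ) : ℤ) x := by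
        rw [partialSum_eq_sum_range, Finset.sum_range_succ, ← partialSum_eq_sum_range]
      rw [this]
      ring
    have hi : Integrable (fun x => partialSum f coord n x ^ 2
        + obs f coord ((n + 1 : ℕ) : ℤ) x ^ 2) P := hS.integrable_sq.add hX.integrable_sq
    have hi' : Integrable
        (fun x => partialSum f coord n x * obs f coord ((n + 1 : ℕ) : ℤ) x) P :=
      hS.integrable_mul hX
    simp_rw [e]
    rw [integral_add hi (hi'.const_mul 2), integral_add hS.integrable_sq hX.integrable_sq,
      integral_const_mul, add_assoc]
    congr 2
    · have := integral_obs_mul_obs hξ hf (n + 1) 0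
      simpa [pow_two] using this
    · congr 1
      have hij : ∀ i ∈ Finset.range n, Integrable (fun x =>
          obs f coord ((i + 1 : ℕ) : ℤ) x * obs f coord ((n + 1 : ℕ) : ℤ) x) P := fun i _ =>
        (memLp_obs hξ hf (i + 1)).integrable_mul hX
      simp_rw [partialSum_eq_sum_range, Finset.sum_mul]
      rw [integral_finsetSum _ hij, ← Finset.sum_range_reflect]
      refine Finset.sum_congr rfl fun i hi => ?_
      have hin := Finset.mem_range.1 hi
      have := integral_obs_mul_obs hξ hf (n - 1 - i + 1) (i + 1)
      rwa [show n - 1 - i + 1 + (i + 1) = n + 1 by omega] at this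

theorem tendsto_integral_partialSum_sq_div (hξ : IsStationaryMarkovChain coord P)
    (hf : MemL20 f (P.map (coord 0))) (hA : Summable fun k => twoSidedNorm f P k ^ 2) :
    Tendsto (fun n : ℕ => (∫ x, partialSum f coord n x ^ 2 ∂P) / n) atTop
      (𝓝 (∫ x, obs f coord 0 x ^ 2 ∂P + 2 * ∑' k : ℕ,
        ∫ x, obs f coord 0 x * obs f coord ((k + 1 : ℕ) : ℤ) x ∂P)) := by
  have hs : Summable fun k : ℕ => ∫ x, obs f coord 0 x * obs f coord ((k + 1 : ℕ) : ℤ) x ∂P :=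
    (summable_nat_add_iff 1).2 (summable_integral_obs_mul_obs hξ hf hA)
  refine ((hs.hasSum.tendsto_sum_nat.const_mul 2).const_add
    (∫ x, obs f coord 0 x ^ 2 ∂P)).cesaro.congr fun n => ?_
  rw [integral_partialSum_sq hξ hf, div_eq_inv_mul]

theorem lpNorm_condExp_obs_eq (hξ : IsStationaryMarkovChain coord P)
    (hf : MemL20 f (P.map (coord 0))) (j d : ℕ) :
    lpNorm (P[obs f coord (j : ℤ) | sigmaAt coord ((j : ℤ) - d) ⊔ sigmaAt coord ((j : ℤ) + d)]) 2 P
      = twoSidedNorm f P d := by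
  have hle := sigmaAt_le hξ.measurable
  have h0 : MemLp (obs f coord 0) 2 P := memLp_obs hξ hf 0
  have h1 := lpNorm_condExp_comp_shift hξ (sup_le (hle (-(d : ℤ))) (hle (d : ℤ)))
    (h0.integrable (by simp)) j (m' := sigmaAt coord ((j : ℤ) - d) ⊔ sigmaAt coord ((j : ℤ) + d))
    (by rw [MeasurableSpace.comap_sup, comap_iterate_shift_sigmaAt, comap_iterate_shift_sigmaAt,
          neg_add_eq_sub, add_comm (d : ℤ)])
  rwa [obs_coord_comp_iterate_shift, zero_add] at h1

/-- The times `0` and `m` lie outside `(j - d, j + d)`, so conditioning on them is coarser than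
conditioning on the chain outside that window, which by the two-sided Markov property amounts to its
two end states. -/
theorem lpNorm_condExp_obs_le (hξ : IsStationaryMarkovChain coord P)
    (hf : MemL20 f (P.map (coord 0))) {j d m : ℕ} (hj : d ≤ j) (hm : j + d ≤ m) :
    lpNorm (P[obs f coord (j : ℤ) | sigmaAt coord 0 ⊔ sigmaAt coord (m : ℤ)]) 2 P
      ≤ twoSidedNorm f P d := by
  have hX := memLp_obs hξ hf j
  have hXm := obs_stronglyMeasurable hf.measurable (coord (S := S)) j
  rw [← lpNorm_condExp_obs_eq hξ hf j d,
    ← lpNorm_two_congr_ae integrable_condExp.1 (hξ.condExp_past_sup_future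
      (a := (j : ℤ) - d) (b := (j : ℤ) + d) (by omega) (hX.integrable (by simp))
      (hXm.mono (sigmaAt_le_future (by omega))) (hXm.mono (sigmaAt_le_past (by omega))))]
  exact lpNorm_condExp_mono
    (sup_le_sup (sigmaAt_le_past (by omega)) (sigmaAt_le_future (by omega)))
    (sup_le (past_le hξ.measurable _) (future_le hξ.measurable _)) hX

theorem lpNorm_condExp_partialSum_le (hξ : IsStationaryMarkovChain coord P)
    (hf : MemL20 f (P.map (coord 0))) (m : ℕ) :
    lpNorm (P[partialSum f coord m | sigmaAt coord 0 ⊔ sigmaAt coord (m : ℤ)]) 2 P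
      ≤ 2 * ∑ j ∈ Finset.range (m + 1), twoSidedNorm f P j := by
  have hmem := fun i => memLp_obs hξ hf i
  have e : partialSum f coord m = ∑ i ∈ Finset.range m, obs f coord ((i + 1 : ℕ) : ℤ) := by
    ext x
    rw [partialSum_eq_sum_range, Finset.sum_apply]
  have h1 := condExp_finsetSum (μ := P) (s := Finset.range m)
    (f := fun i => obs f coord ((i + 1 : ℕ) : ℤ))
    (fun i _ => (hmem (i + 1)).integrable (by simp)) (sigmaAt coord 0 ⊔ sigmaAt coord (m : ℤ))
  rw [e, lpNorm_two_congr_ae integrable_condExp.1 h1]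
  have h2 : ∀ i ∈ Finset.range m,
      lpNorm (P[obs f coord ((i + 1 : ℕ) : ℤ) | sigmaAt coord 0 ⊔ sigmaAt coord (m : ℤ)]) 2 P
        ≤ twoSidedNorm f P (i + 1) + twoSidedNorm f P (m - 1 - i) := by
    intro i hi
    have him := Finset.mem_range.1 hi
    -- The usable window has radius the distance from time `i + 1` to the nearer of `0` and `m`,
    -- namely `i + 1` or `m - 1 - i`. Adding both norms avoids the case split in the final sum.
    rcases le_total (2 * (i + 1)) m with h | h
    · exact (lpNorm_condExp_obs_le hξ hf le_rfl (by omega)).trans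
        (le_add_of_nonneg_right (twoSidedNorm_nonneg _ _ _))
    · exact (lpNorm_condExp_obs_le hξ hf (d := m - 1 - i) (by omega) (by omega)).trans
        (le_add_of_nonneg_left (twoSidedNorm_nonneg _ _ _))
  refine (lpNorm_sum_le (fun i _ => (hmem (i + 1)).condExp (by simp)) (by simp)).trans
    ((Finset.sum_le_sum h2).trans ?_)
  rw [Finset.sum_add_distrib, Finset.sum_range_reflect (fun j => twoSidedNorm f P j), two_mul]
  refine add_le_add ?_ ?_
  · rw [Finset.sum_range_succ']
    exact le_add_of_nonneg_right (twoSidedNorm_nonneg _ _ _)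
  · rw [Finset.sum_range_succ]
    exact le_add_of_nonneg_right (twoSidedNorm_nonneg _ _ _)

theorem tendsto_integral_condExp_partialSum_sq_div (hξ : IsStationaryMarkovChain coord P)
    (hf : MemL20 f (P.map (coord 0))) (hA : Summable fun k => twoSidedNorm f P k ^ 2) :
    Tendsto (fun m : ℕ => (∫ x, (P[partialSum f coord m |
      sigmaAt coord 0 ⊔ sigmaAt coord (m : ℤ)]) x ^ 2 ∂P) / m) atTop (𝓝 0) := by
  -- The factor `8` is `2²` from the norm bound times `2` from `m + 1 ≤ 2m`.
  have h := ((tendsto_sq_sum_div hA).comp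
    (tendsto_add_atTop_nat 1)).const_mul 8
  rw [mul_zero] at h
  refine squeeze_zero' (.of_forall fun m => div_nonneg
    (integral_nonneg fun _ => sq_nonneg _) (Nat.cast_nonneg m)) ?_ h
  filter_upwards [eventually_ge_atTop 1] with m hm
  have hm' : (1 : ℝ) ≤ m := by exact_mod_cast hm
  rw [← lpNorm_two_sq ((memLp_partialSum hξ hf m).condExp (by simp))]
  have h1 : lpNorm (P[partialSum f coord m | sigmaAt coord 0 ⊔ sigmaAt coord (m : ℤ)]) 2 P ^ 2
      ≤ (2 * ∑ j ∈ Finset.range (m + 1), twoSidedNorm f P j) ^ 2 :=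
    pow_le_pow_left₀ lpNorm_nonneg (lpNorm_condExp_partialSum_le hξ hf m) 2
  simp only [Function.comp_apply]
  rw [← mul_div_assoc, div_le_div_iff₀ (by positivity) (by positivity)]
  push_cast
  nlinarith [sq_nonneg (∑ j ∈ Finset.range (m + 1), twoSidedNorm f P j)]

end Canonical

/-! ### Orthogonality of the centered blocks; comparison of characteristic functions. -/

section Orthogonality

variable {Ω : Type*} {mΩ : MeasurableSpace Ω} {μ : Measure Ω} [IsProbabilityMeasure μ]

/-- Each `D k` is orthogonal to the earlier `D l` and to `W`, all of which are `H k`-measurable, so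
the squares add up. -/
theorem IsOuterCentered.integral_sum_add_sq {D V : ℕ → Ω → ℝ} {H : ℕ → MeasurableSpace Ω}
    (h : IsOuterCentered D V H μ) {W : Ω → ℝ} (hW : MemLp W 2 μ)
    (hWm : ∀ j, StronglyMeasurable[H j] W) (k : ℕ) :
    ∫ ω, (∑ l ∈ Finset.range k, D l ω + W ω) ^ 2 ∂μ
      = ∑ l ∈ Finset.range k, ∫ ω, D l ω ^ 2 ∂μ + ∫ ω, W ω ^ 2 ∂μ := by
  induction k with
  | zero => simp
  | succ k ih =>
    set Q : Ω → ℝ := fun ω => ∑ l ∈ Finset.range k, D l ω + W ω with hQ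
    have hQ2 : MemLp Q 2 μ := (memLp_finsetSum _ fun l _ => h.memLp l).add hW
    have hQm : StronglyMeasurable[H k] Q :=
      (Finset.stronglyMeasurable_fun_sum _ fun l hl =>
        h.measurable_of_ne l k (Finset.mem_range.1 hl).ne).add (hWm k)
    have hDQ : Integrable (fun ω => D k ω * Q ω) μ := (h.memLp k).integrable_mul hQ2
    have h0 := integral_mul_eq_zero_of_condExp (h.le k) ((h.memLp k).integrable (by simp))
      (h.condExp_eq_zero k) hQm hDQ
    have e : ∀ ω, (∑ l ∈ Finset.range (k + 1), D l ω + W ω) ^ 2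
        = Q ω ^ 2 + D k ω ^ 2 + 2 * (D k ω * Q ω) := by
      intro ω
      rw [Finset.sum_range_succ, hQ]
      ring
    have hi : Integrable (fun ω => Q ω ^ 2 + D k ω ^ 2) μ :=
      hQ2.integrable_sq.add (h.memLp k).integrable_sq
    simp_rw [e]
    rw [integral_add hi (hDQ.const_mul 2), integral_add hQ2.integrable_sq
      (h.memLp k).integrable_sq, integral_const_mul, h0, ih, Finset.sum_range_succ]
    ring

theorem norm_integral_exp_sub_le {Z W : Ω → ℝ} (hZ : MemLp Z 2 μ) (hW : MemLp W 2 μ) (u : ℝ) :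
    ‖∫ ω, Complex.exp (Complex.I * (u * Z ω : ℝ)) ∂μ
      - ∫ ω, Complex.exp (Complex.I * (u * W ω : ℝ)) ∂μ‖
      ≤ |u| * lpNorm (fun ω => Z ω - W ω) 2 μ := by
  have hi : ∀ {Y : Ω → ℝ}, MemLp Y 2 μ →
      Integrable (fun ω => Complex.exp (Complex.I * (u * Y ω : ℝ))) μ := fun {Y} hY =>
    (integrable_const (1 : ℝ)).mono' ((show Continuous fun x : ℝ =>
      Complex.exp (Complex.I * (u * x : ℝ)) by fun_prop).comp_aestronglyMeasurable hY.1)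
      (.of_forall fun ω => (norm_exp_I_mul_ofReal _).le)
  have hZW : MemLp (fun ω => Z ω - W ω) 2 μ := hZ.sub hW
  rw [← integral_sub (hi hZ) (hi hW)]
  refine le_trans ?_ (mul_le_mul_of_nonneg_left (integral_abs_le_lpNorm hZW) (abs_nonneg u))
  rw [← integral_const_mul]
  refine norm_integral_le_of_norm_le ((hZW.integrable (by simp)).abs.const_mul _)
    (.of_forall fun ω => ?_)
  have e : Complex.exp (Complex.I * (u * Z ω : ℝ)) - Complex.exp (Complex.I * (u * W ω : ℝ))
      = Complex.exp (Complex.I * (u * W ω : ℝ))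
        * (Complex.exp (Complex.I * (u * (Z ω - W ω) : ℝ)) - 1) := by
    rw [mul_sub, ← Complex.exp_add, mul_one]
    congr 2
    push_cast
    ring
  rw [e, norm_mul, norm_exp_I_mul_ofReal, one_mul, ← abs_mul]
  exact Real.norm_exp_I_mul_ofReal_sub_one_le

end Orthogonality

/-! ### Block decomposition of the partial sums. -/

section Blocks

variable {S : Type*} [MeasurableSpace S] {P : Measure (ℤ → S)} [IsProbabilityMeasure P]
  {f : S → ℝ}

/-- `E(S_m | ξ_0, ξ_m)`. -/
noncomputable def blockMean (f : S → ℝ) (P : Measure (ℤ → S)) (m : ℕ) : (ℤ → S) → ℝ :=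
  P[partialSum f coord m | sigmaAt coord 0 ⊔ sigmaAt coord (m : ℤ)]

/-- `S_m - E(S_m | ξ_0, ξ_m)`. -/
noncomputable def blockDiff (f : S → ℝ) (P : Measure (ℤ → S)) (m : ℕ) : (ℤ → S) → ℝ :=
  fun x => partialSum f coord m x - blockMean f P m x

/-- The conditional variance of `S_m` given `ξ_0, ξ_m`, in a nonnegative version. -/
noncomputable def blockVar (f : S → ℝ) (P : Measure (ℤ → S)) (m : ℕ) : (ℤ → S) → ℝ :=
  fun x => |(P[fun x => blockDiff f P m x ^ 2 | sigmaAt coord 0 ⊔ sigmaAt coord (m : ℤ)]) x|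

/-- The sigma-algebra generated by the chain outside the `l`-th block of length `m`. -/
abbrev outer (S : Type*) [MeasurableSpace S] (m l : ℕ) : MeasurableSpace (ℤ → S) :=
  past coord ((m * l : ℕ) : ℤ) ⊔ future coord ((m * (l + 1) : ℕ) : ℤ)

omit [IsProbabilityMeasure P] in
theorem memLp_blockMean (hξ : IsStationaryMarkovChain coord P)
    (hf : MemL20 f (P.map (coord 0))) (m : ℕ) : MemLp (blockMean f P m) 2 P :=
  (memLp_partialSum hξ hf m).condExp (by simp)

omit [IsProbabilityMeasure P] in
theorem memLp_blockDiff (hξ : IsStationaryMarkovChain coord P)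
    (hf : MemL20 f (P.map (coord 0))) (m : ℕ) : MemLp (blockDiff f P m) 2 P :=
  (memLp_partialSum hξ hf m).sub (memLp_blockMean hξ hf m)

omit [IsProbabilityMeasure P] in
theorem integrable_blockVar (m : ℕ) : Integrable (blockVar f P m) P := integrable_condExp.abs

omit [IsProbabilityMeasure P] in
theorem sup_sigmaAt_le (hξ : IsStationaryMarkovChain (coord (S := S)) P) (m : ℕ) :
    sigmaAt (coord (S := S)) 0 ⊔ sigmaAt coord (m : ℤ) ≤ MeasurableSpace.pi :=
  sup_le (sigmaAt_le hξ.measurable _) (sigmaAt_le hξ.measurable _)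

theorem sup_sigmaAt_le_past (m : ℕ) :
    sigmaAt (coord (S := S)) 0 ⊔ sigmaAt coord (m : ℤ) ≤ past coord (m : ℤ) :=
  sup_le (sigmaAt_le_past (by omega)) (sigmaAt_le_past le_rfl)

theorem sup_sigmaAt_le_future (m : ℕ) :
    sigmaAt (coord (S := S)) 0 ⊔ sigmaAt coord (m : ℤ) ≤ future coord 0 :=
  sup_le (sigmaAt_le_future le_rfl) (sigmaAt_le_future (by omega))

theorem partialSum_stronglyMeasurable_past (hf : Measurable f) (m : ℕ) :
    StronglyMeasurable[past coord (m : ℤ)] (partialSum f (coord (S := S)) m) :=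
  Finset.stronglyMeasurable_fun_sum _ fun i hi => (obs_stronglyMeasurable hf coord i).mono
    (sigmaAt_le_past (by have := Finset.mem_Icc.1 hi; omega))

theorem partialSum_stronglyMeasurable_future (hf : Measurable f) (m : ℕ) :
    StronglyMeasurable[future coord 0] (partialSum f (coord (S := S)) m) :=
  Finset.stronglyMeasurable_fun_sum _ fun i hi => (obs_stronglyMeasurable hf coord i).mono
    (sigmaAt_le_future (by omega))

omit [IsProbabilityMeasure P] in
theorem blockMean_stronglyMeasurable (m : ℕ) :
    StronglyMeasurable[sigmaAt coord 0 ⊔ sigmaAt coord (m : ℤ)] (blockMean f P m) :=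
  stronglyMeasurable_condExp

omit [IsProbabilityMeasure P] in
theorem blockVar_stronglyMeasurable (m : ℕ) :
    StronglyMeasurable[sigmaAt coord 0 ⊔ sigmaAt coord (m : ℤ)] (blockVar f P m) :=
  continuous_abs.comp_stronglyMeasurable stronglyMeasurable_condExp

omit [IsProbabilityMeasure P] in
theorem blockDiff_stronglyMeasurable_past (hf : Measurable f) (m : ℕ) :
    StronglyMeasurable[past coord (m : ℤ)] (blockDiff f P m) :=
  (partialSum_stronglyMeasurable_past hf m).sub
    ((blockMean_stronglyMeasurable m).mono (sup_sigmaAt_le_past m))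

omit [IsProbabilityMeasure P] in
theorem blockDiff_stronglyMeasurable_future (hf : Measurable f) (m : ℕ) :
    StronglyMeasurable[future coord 0] (blockDiff f P m) :=
  (partialSum_stronglyMeasurable_future hf m).sub
    ((blockMean_stronglyMeasurable m).mono (sup_sigmaAt_le_future m))

theorem condExp_blockDiff (hξ : IsStationaryMarkovChain coord P)
    (hf : MemL20 f (P.map (coord 0))) (m : ℕ) :
    P[blockDiff f P m | sigmaAt coord 0 ⊔ sigmaAt coord (m : ℤ)] =ᵐ[P] 0 := by
  have h := condExp_sub (μ := P) ((memLp_partialSum hξ hf m).integrable (by simp))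
    ((memLp_blockMean hξ hf m).integrable (by simp)) (sigmaAt coord 0 ⊔ sigmaAt coord (m : ℤ))
  rw [condExp_of_stronglyMeasurable (f := blockMean f P m) (sup_sigmaAt_le hξ m)
    (blockMean_stronglyMeasurable m) ((memLp_blockMean hξ hf m).integrable (by simp))] at h
  refine h.trans (.of_eq ?_)
  rw [blockMean, sub_self]

omit [IsProbabilityMeasure P] in
theorem condExp_blockDiff_sq (m : ℕ) :
    P[fun x => blockDiff f P m x ^ 2 | sigmaAt coord 0 ⊔ sigmaAt coord (m : ℤ)]
      =ᵐ[P] blockVar f P m := by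
  have h : 0 ≤ᵐ[P] P[fun x => blockDiff f P m x ^ 2 |
      sigmaAt coord 0 ⊔ sigmaAt coord (m : ℤ)] :=
    condExp_nonneg (.of_forall fun x => sq_nonneg _)
  filter_upwards [h] with x hx
  exact (abs_of_nonneg hx).symm

theorem integral_blockVar (hξ : IsStationaryMarkovChain coord P) (m : ℕ) :
    ∫ x, blockVar f P m x ∂P = ∫ x, blockDiff f P m x ^ 2 ∂P := by
  rw [← integral_condExp (sup_sigmaAt_le hξ m) (μ := P) (f := fun x => blockDiff f P m x ^ 2)]
  exact (integral_congr_ae (condExp_blockDiff_sq m)).symm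

theorem comap_iterate_shift_sup (m j : ℕ) :
    (sigmaAt (coord (S := S)) 0 ⊔ sigmaAt coord (m : ℤ)).comap shift^[j]
      = sigmaAt coord (j : ℤ) ⊔ sigmaAt coord ((j + m : ℕ) : ℤ) := by
  rw [MeasurableSpace.comap_sup, comap_iterate_shift_sigmaAt, comap_iterate_shift_sigmaAt,
    zero_add, Nat.cast_add, add_comm (m : ℤ)]

theorem comp_shift_stronglyMeasurable_past {g : (ℤ → S) → ℝ} {m : ℕ}
    (hg : StronglyMeasurable[past coord (m : ℤ)] g) (l : ℕ) :
    StronglyMeasurable[past coord ((m * (l + 1) : ℕ) : ℤ)] (g ∘ shift^[m * l]) :=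
  (stronglyMeasurable_comp_comap hg).mono ((comap_iterate_shift_past_le _ _).trans
    (past_mono (by push_cast; linarith)))

theorem comp_shift_stronglyMeasurable_future {g : (ℤ → S) → ℝ} {m : ℕ}
    (hg : StronglyMeasurable[future coord 0] g) (l : ℕ) :
    StronglyMeasurable[future coord ((m * l : ℕ) : ℤ)] (g ∘ shift^[m * l]) :=
  (stronglyMeasurable_comp_comap hg).mono ((comap_iterate_shift_future_le _ _).trans
    (future_anti (by simp)))

/-- Two distinct blocks overlap in at most one end state, so block `l` lies wholly before or wholly
after the interior of block `r`. -/
theorem comp_shift_stronglyMeasurable_outer_of_ne {g : (ℤ → S) → ℝ} {m : ℕ}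
    (hp : StronglyMeasurable[past coord (m : ℤ)] g) (hq : StronglyMeasurable[future coord 0] g)
    {l r : ℕ} (hlr : l ≠ r) : StronglyMeasurable[outer S m r] (g ∘ shift^[m * l]) := by
  rcases lt_or_gt_of_ne hlr with h | h
  · exact (comp_shift_stronglyMeasurable_past hp l).mono (le_sup_of_le_left
      (past_mono (by exact_mod_cast Nat.mul_le_mul_left m h)))
  · exact (comp_shift_stronglyMeasurable_future hq l).mono (le_sup_of_le_right
      (future_anti (by exact_mod_cast Nat.mul_le_mul_left m h)))

/-- For functions of the end states alone the case `l = r` is allowed too, since the outer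
sigma-algebra retains both ends of its block. -/
theorem comp_shift_stronglyMeasurable_outer {g : (ℤ → S) → ℝ} {m : ℕ}
    (hg : StronglyMeasurable[sigmaAt coord 0 ⊔ sigmaAt coord (m : ℤ)] g) (l r : ℕ) :
    StronglyMeasurable[outer S m r] (g ∘ shift^[m * l]) := by
  by_cases h : l = r
  · subst h
    have h1 := stronglyMeasurable_comp_comap (φ := shift^[m * l]) hg
    rw [comap_iterate_shift_sup] at h1
    exact h1.mono (sup_le_sup (sigmaAt_le_past le_rfl) (sigmaAt_le_future (by rw [mul_add_one])))
  · exact comp_shift_stronglyMeasurable_outer_of_ne (hg.mono (sup_sigmaAt_le_past m))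
      (hg.mono (sup_sigmaAt_le_future m)) h

theorem condExp_outer_comp_shift (hξ : IsStationaryMarkovChain coord P) {g : (ℤ → S) → ℝ} {m : ℕ}
    (hg : Integrable g P) (hp : StronglyMeasurable[past coord (m : ℤ)] g)
    (hq : StronglyMeasurable[future coord 0] g) (l : ℕ) :
    P[g ∘ shift^[m * l] | outer S m l]
      =ᵐ[P] P[g | sigmaAt coord 0 ⊔ sigmaAt coord (m : ℤ)] ∘ shift^[m * l] := by
  have h1 := hξ.condExp_past_sup_future (a := ((m * l : ℕ) : ℤ)) (b := ((m * (l + 1) : ℕ) : ℤ))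
    (by exact_mod_cast Nat.mul_le_mul_left m (Nat.le_succ l))
    ((hξ.measurePreserving_shift (m * l)).integrable_comp_of_integrable hg)
    (comp_shift_stronglyMeasurable_future hq l) (comp_shift_stronglyMeasurable_past hp l)
  have h2 := condExp_comp_measurePreserving (hξ.measurePreserving_shift (m * l))
    (sup_sigmaAt_le hξ m) hg
  rw [comap_iterate_shift_sup, ← mul_add_one] at h2
  exact h1.trans h2

theorem isOuterCentered_blockDiff (hξ : IsStationaryMarkovChain coord P)
    (hf : MemL20 f (P.map (coord 0))) (m : ℕ) :
    IsOuterCentered (fun l => blockDiff f P m ∘ shift^[m * l])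
      (fun l => blockVar f P m ∘ shift^[m * l]) (outer S m) P where
  le l := sup_le (past_le hξ.measurable _) (future_le hξ.measurable _)
  memLp l := (memLp_blockDiff hξ hf m).comp_measurePreserving (hξ.measurePreserving_shift _)
  integrable l := (hξ.measurePreserving_shift _).integrable_comp_of_integrable
    (integrable_blockVar m)
  nonneg l x := abs_nonneg _
  measurable_of_ne l j hlj := comp_shift_stronglyMeasurable_outer_of_ne
    (blockDiff_stronglyMeasurable_past hf.measurable m)
    (blockDiff_stronglyMeasurable_future hf.measurable m) hlj
  measurable_var l j := comp_shift_stronglyMeasurable_outer (blockVar_stronglyMeasurable m) l j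
  condExp_eq_zero l := by
    refine (condExp_outer_comp_shift hξ ((memLp_blockDiff hξ hf m).integrable (by simp))
      (blockDiff_stronglyMeasurable_past hf.measurable m)
      (blockDiff_stronglyMeasurable_future hf.measurable m) l).trans ?_
    exact (hξ.measurePreserving_shift (m * l)).quasiMeasurePreserving.ae_eq_comp
      (condExp_blockDiff hξ hf m)
  condExp_sq l := by
    refine (condExp_outer_comp_shift hξ (memLp_blockDiff hξ hf m).integrable_sq
      ((blockDiff_stronglyMeasurable_past hf.measurable m).pow 2)
      ((blockDiff_stronglyMeasurable_future hf.measurable m).pow 2) l).trans ?_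
    exact (hξ.measurePreserving_shift (m * l)).quasiMeasurePreserving.ae_eq_comp
      (condExp_blockDiff_sq m)

theorem integral_blockDiff_sq (hξ : IsStationaryMarkovChain coord P)
    (hf : MemL20 f (P.map (coord 0))) (m : ℕ) :
    ∫ x, blockDiff f P m x ^ 2 ∂P
      = ∫ x, partialSum f coord m x ^ 2 ∂P - ∫ x, blockMean f P m x ^ 2 ∂P :=
  integral_sub_condExp_sq (sup_sigmaAt_le hξ m) (memLp_partialSum hξ hf m)

/-- The difference is the sum `W` of block means, orthogonal to every centered block. Its norm is
thus computed exactly, with no estimate of correlations between block means. -/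
theorem integral_partialSum_sub_sum_blockDiff_sq (hξ : IsStationaryMarkovChain coord P)
    (hf : MemL20 f (P.map (coord 0))) (m k : ℕ) :
    ∫ x, (partialSum f coord (m * k) x
        - ∑ l ∈ Finset.range k, blockDiff f P m (shift^[m * l] x)) ^ 2 ∂P
      = ∫ x, partialSum f coord (m * k) x ^ 2 ∂P - k * ∫ x, blockDiff f P m x ^ 2 ∂P := by
  set W : (ℤ → S) → ℝ := fun x => ∑ l ∈ Finset.range k, blockMean f P m (shift^[m * l] x) with hW
  have hW2 : MemLp W 2 P := memLp_finsetSum _ fun l _ =>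
    (memLp_blockMean hξ hf m).comp_measurePreserving (hξ.measurePreserving_shift (m * l))
  have hWm : ∀ j, StronglyMeasurable[outer S m j] W := fun j =>
    Finset.stronglyMeasurable_fun_sum _ fun l _ =>
      comp_shift_stronglyMeasurable_outer (blockMean_stronglyMeasurable m) l j
  have e : ∀ x, partialSum f coord (m * k) x
      = ∑ l ∈ Finset.range k, (blockDiff f P m ∘ shift^[m * l]) x + W x := by
    intro x
    rw [partialSum_block, hW, ← Finset.sum_add_distrib]
    refine Finset.sum_congr rfl fun l _ => ?_
    simp [blockDiff]
  have h := (isOuterCentered_blockDiff hξ hf m).integral_sum_add_sq hW2 hWm k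
  have hL : ∀ x, partialSum f coord (m * k) x
      - ∑ l ∈ Finset.range k, blockDiff f P m (shift^[m * l] x) = W x := fun x => by
    rw [e]
    exact add_sub_cancel_left _ _
  simp_rw [hL, e]
  rw [h]
  have hD : ∀ l : ℕ, ∫ x, (blockDiff f P m ∘ shift^[m * l]) x ^ 2 ∂P
      = ∫ x, blockDiff f P m x ^ 2 ∂P := fun l =>
    integral_comp_measurePreserving (g := fun x => blockDiff f P m x ^ 2)
      (hξ.measurePreserving_shift (m * l)) ((memLp_blockDiff hξ hf m).1.pow 2)
  simp_rw [hD]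
  rw [Finset.sum_const, Finset.card_range, nsmul_eq_mul, add_sub_cancel_left]

theorem tendsto_integral_exp_sum_blockDiff (hξ : IsStationaryMarkovChain coord P)
    (herg : TotallyErgodic coord P) (hf : MemL20 f (P.map (coord 0))) {m : ℕ} (hm : 1 ≤ m)
    {u : ℕ → ℝ} {K : ℕ → ℕ} {τ : ℝ} (hK : Tendsto K atTop atTop)
    (huK : Tendsto (fun n => u n ^ 2 * K n) atTop (𝓝 τ)) :
    Tendsto (fun n => ∫ x, Complex.exp (Complex.I *
        (u n * ∑ l ∈ Finset.range (K n), blockDiff f P m (shift^[m * l] x) : ℝ)) ∂P)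
      atTop (𝓝 (Real.exp (-(τ * (∫ x, blockDiff f P m x ^ 2 ∂P) / 2)) : ℂ)) := by
  -- Total ergodicity enters here: consecutive blocks are related by `θ^m`, not by `θ`.
  have hT : Ergodic shift^[m] P := by
    have := herg m hm
    rwa [pathLaw_coord] at this
  have hident : ∀ {g : (ℤ → S) → ℝ}, AEStronglyMeasurable g P → ∀ j,
      IdentDistrib (g ∘ shift^[m * j]) (g ∘ shift^[m * 0]) P P := by
    intro g hg j
    have hmp := hξ.measurePreserving_shift (m * j)
    refine ⟨(hg.comp_measurePreserving hmp).aemeasurable, hg.aemeasurable, ?_⟩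
    rw [← AEMeasurable.map_map_of_aemeasurable (by rw [hmp.map_eq]; exact hg.aemeasurable)
      hmp.aemeasurable, hmp.map_eq]
    rfl
  refine (isOuterCentered_blockDiff hξ hf m).tendsto_integral_exp
    (hident (memLp_blockDiff hξ hf m).1) (hident (integrable_blockVar m).1)
    (integral_nonneg fun _ => sq_nonneg _) ?_ hK huK
  have h := tendsto_integral_abs_average_sub hT (integrable_blockVar (f := f) (P := P) m)
  simp only [← Function.iterate_mul, integral_blockVar hξ] at h
  exact h

end Blocks

/-! ### Passage to the limit in the block length. -/

section Limit

/-- Iterated limit: first `n → ∞` with the block length `m` fixed, then `m → ∞`. -/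
theorem tendsto_of_tendsto_approx {φ : ℕ → ℂ} {z : ℕ → ℕ → ℂ} {e : ℕ → ℕ → ℝ} {Z : ℕ → ℂ}
    {E : ℕ → ℝ} {L : ℂ} (hz : ∀ᶠ m in atTop, Tendsto (z m) atTop (𝓝 (Z m)))
    (he : ∀ᶠ m in atTop, Tendsto (e m) atTop (𝓝 (E m)))
    (hφ : ∀ᶠ m in atTop, ∀ᶠ n in atTop, ‖φ n - z m n‖ ≤ e m n)
    (hZ : Tendsto Z atTop (𝓝 L)) (hE : Tendsto E atTop (𝓝 0)) : Tendsto φ atTop (𝓝 L) := by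
  rw [Metric.tendsto_nhds]
  intro ε hε
  have hε3 : 0 < ε / 3 := by positivity
  obtain ⟨m, h1, h2, h3, h4, h5⟩ := (hz.and (he.and (hφ.and
    ((Metric.tendsto_nhds.1 hZ (ε / 3) hε3).and (hE.eventually (gt_mem_nhds hε3)))))).exists
  filter_upwards [h3, Metric.tendsto_nhds.1 h1 (ε / 3) hε3, h2.eventually (gt_mem_nhds h5)]
    with n h6 h7 h8
  have h9 := dist_triangle4 (φ n) (z m n) (Z m) L
  rw [dist_eq_norm (φ n) (z m n)] at h9
  linarith

variable {S : Type*} [MeasurableSpace S] {P : Measure (ℤ → S)} [IsProbabilityMeasure P]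
  {f : S → ℝ}

theorem tendsto_natCast_div_div {m : ℕ} (hm : 1 ≤ m) :
    Tendsto (fun n : ℕ => ((n / m : ℕ) : ℝ) / n) atTop (𝓝 (m : ℝ)⁻¹) := by
  refine ((tendsto_nat_floor_mul_div_atTop (R := ℝ) (a := (m : ℝ)⁻¹) (by positivity)).comp
    tendsto_natCast_atTop_atTop).congr fun n => ?_
  rw [Function.comp_apply, inv_mul_eq_div, Nat.floor_div_natCast, Nat.floor_natCast]

/-- Besides the complete blocks there is a shifted partial sum of length `n % m < m`. Bounding it by
the sum over all possible lengths gives a constant independent of `n`, negligible after division by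
`√n`. -/
theorem lpNorm_partialSum_sub_le (hξ : IsStationaryMarkovChain coord P)
    (hf : MemL20 f (P.map (coord 0))) {m : ℕ} (hm : 1 ≤ m) (n : ℕ) :
    lpNorm (fun x => partialSum f coord n x
        - ∑ l ∈ Finset.range (n / m), blockDiff f P m (shift^[m * l] x)) 2 P
      ≤ ∑ r ∈ Finset.range m, lpNorm (partialSum f coord r) 2 P
        + √(∫ x, partialSum f coord (m * (n / m)) x ^ 2 ∂P
          - (n / m : ℕ) * ∫ x, blockDiff f P m x ^ 2 ∂P) := by
  set k := n / m with hk
  have hmp := hξ.measurePreserving_shift (m * k)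
  have hT : MemLp (fun x => ∑ l ∈ Finset.range k, blockDiff f P m (shift^[m * l] x)) 2 P :=
    memLp_finsetSum _ fun l _ =>
      (memLp_blockDiff hξ hf m).comp_measurePreserving (hξ.measurePreserving_shift (m * l))
  have h2 : MemLp (fun x => partialSum f coord (m * k) x
      - ∑ l ∈ Finset.range k, blockDiff f P m (shift^[m * l] x)) 2 P :=
    (memLp_partialSum hξ hf _).sub hT
  have h1 := (memLp_partialSum hξ hf (n % m)).comp_measurePreserving hmp
  have e : (fun x => partialSum f coord n x
        - ∑ l ∈ Finset.range k, blockDiff f P m (shift^[m * l] x))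
      = partialSum f coord (n % m) ∘ shift^[m * k] + fun x => partialSum f coord (m * k) x
        - ∑ l ∈ Finset.range k, blockDiff f P m (shift^[m * l] x) := by
    ext x
    have : partialSum f coord n x = partialSum f coord (m * k) x
        + partialSum f coord (n % m) (shift^[m * k] x) := by
      rw [← partialSum_add, hk, Nat.div_add_mod]
    rw [this, Pi.add_apply, Function.comp_apply]
    ring
  rw [e]
  refine (lpNorm_add_le h1 (by simp)).trans (add_le_add ?_ (le_of_eq ?_))
  · rw [lpNorm_comp_measurePreserving hmp (memLp_partialSum hξ hf _).1]
    exact Finset.single_le_sum (f := fun r => lpNorm (partialSum f coord r) 2 P)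
      (fun r _ => lpNorm_nonneg) (Finset.mem_range.2 (Nat.mod_lt n hm))
  · rw [← integral_partialSum_sub_sum_blockDiff_sq hξ hf, ← lpNorm_two_sq h2,
      Real.sqrt_sq lpNorm_nonneg]

theorem tendsto_integral_exp_partialSum (hξ : IsStationaryMarkovChain coord P)
    (herg : TotallyErgodic coord P) (hf : MemL20 f (P.map (coord 0)))
    (hA : Summable fun k => twoSidedNorm f P k ^ 2) {v : ℝ}
    (hv : Tendsto (fun n : ℕ => (∫ x, partialSum f coord n x ^ 2 ∂P) / n) atTop (𝓝 v)) (t : ℝ) :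
    Tendsto (fun n : ℕ => ∫ x, Complex.exp (Complex.I *
      (t / √(n : ℝ) * partialSum f coord n x : ℝ)) ∂P) atTop
      (𝓝 (Real.exp (-(t ^ 2 * v / 2)) : ℂ)) := by
  set w : ℕ → ℝ := fun m => ∫ x, blockDiff f P m x ^ 2 ∂P with hw
  -- Centering the blocks costs asymptotically no variance.
  have hwv : Tendsto (fun m : ℕ => w m / m) atTop (𝓝 v) := by
    have := hv.sub (tendsto_integral_condExp_partialSum_sq_div hξ hf hA)
    rw [sub_zero] at this
    refine this.congr fun m => ?_
    rw [show w m = _ from integral_blockDiff_sq hξ hf m, sub_div]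
    rfl
  refine tendsto_of_tendsto_approx
    (z := fun m n => ∫ x, Complex.exp (Complex.I * (t / √(n : ℝ) *
      ∑ l ∈ Finset.range (n / m), blockDiff f P m (shift^[m * l] x) : ℝ)) ∂P)
    (Z := fun m => (Real.exp (-(t ^ 2 / m * w m / 2)) : ℂ))
    (e := fun m n => |t / √(n : ℝ)| * (∑ r ∈ Finset.range m, lpNorm (partialSum f coord r) 2 P
        + √(∫ x, partialSum f coord (m * (n / m)) x ^ 2 ∂P - (n / m : ℕ) * w m)))
    (E := fun m => |t| * √(v - w m / m)) ?_ ?_ ?_ ?_ ?_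
  -- The block theorem with `u = t/√n` and `K = n / m`, so that `u²K → t²/m`.
  · filter_upwards [eventually_ge_atTop 1] with m hm
    refine tendsto_integral_exp_sum_blockDiff hξ herg hf hm
      (Nat.tendsto_div_const_atTop (by omega)) ?_
    have := (tendsto_natCast_div_div hm).const_mul (t ^ 2)
    rw [← div_eq_mul_inv] at this
    refine this.congr fun n => ?_
    rw [div_pow, Real.sq_sqrt (Nat.cast_nonneg n)]
    ring
  -- The incomplete block contributes `O(1/√n)`; the orthogonal remainder contributes `|t| √(v - w m
  -- / m)` in the limit.
  · filter_upwards [eventually_ge_atTop 1] with m hm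
    have hm0 : (m : ℝ) ≠ 0 := by positivity
    have hK : Tendsto (fun n : ℕ => m * (n / m)) atTop atTop :=
      (Nat.tendsto_div_const_atTop (by omega : m ≠ 0)).const_mul_atTop' (by omega)
    have h1 : Tendsto (fun n : ℕ => (∫ x, partialSum f coord (m * (n / m)) x ^ 2 ∂P) / n)
        atTop (𝓝 v) := by
      have := (hv.comp hK).mul ((tendsto_natCast_div_div hm).const_mul (m : ℝ))
      rw [mul_inv_cancel₀ hm0, mul_one] at this
      refine this.congr' ?_
      filter_upwards [hK.eventually_gt_atTop 0] with n hn
      have : ((m * (n / m) : ℕ) : ℝ) ≠ 0 := by positivity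
      rw [Function.comp_apply, ← mul_div_assoc (m : ℝ), ← Nat.cast_mul]
      field_simp
    have h2 : Tendsto (fun n : ℕ => |t| * √((∫ x, partialSum f coord (m * (n / m)) x ^ 2 ∂P
        - (n / m : ℕ) * w m) / n)) atTop (𝓝 (|t| * √(v - w m / m))) := by
      refine Tendsto.const_mul _ (Tendsto.sqrt ?_)
      have := h1.sub ((tendsto_natCast_div_div hm).mul_const (w m))
      rw [inv_mul_eq_div] at this
      exact this.congr fun n => by ring
    have h3 : Tendsto (fun n : ℕ => |t| * (∑ r ∈ Finset.range m,
        lpNorm (partialSum f coord r) 2 P) * (√(n : ℝ))⁻¹) atTop (𝓝 0) := by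
      have := (tendsto_inv_atTop_zero.comp (Real.tendsto_sqrt_atTop.comp
        tendsto_natCast_atTop_atTop)).const_mul
        (|t| * ∑ r ∈ Finset.range m, lpNorm (partialSum f coord r) 2 P)
      rwa [mul_zero] at this
    have h4 := h3.add h2
    rw [zero_add] at h4
    refine h4.congr fun n => ?_
    rw [abs_div, abs_of_nonneg (Real.sqrt_nonneg _), Real.sqrt_div' _ (Nat.cast_nonneg n)]
    ring
  · filter_upwards [eventually_ge_atTop 1] with m hm
    refine .of_forall fun n => ?_
    have hT : MemLp (fun x => ∑ l ∈ Finset.range (n / m),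
        blockDiff f P m (shift^[m * l] x)) 2 P := memLp_finsetSum _ fun l _ =>
      (memLp_blockDiff hξ hf m).comp_measurePreserving (hξ.measurePreserving_shift (m * l))
    refine (norm_integral_exp_sub_le (memLp_partialSum hξ hf n) hT _).trans ?_
    exact mul_le_mul_of_nonneg_left (lpNorm_partialSum_sub_le hξ hf hm n) (abs_nonneg _)
  · refine (Complex.continuous_ofReal.tendsto _).comp ((Real.continuous_exp.tendsto _).comp ?_)
    refine ((hwv.const_mul (t ^ 2)).div_const 2).neg.congr fun m => ?_
    ring
  · have := ((tendsto_const_nhds (x := v)).sub hwv).sqrt.const_mul |t|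
    simpa using this

end Limit

/-! ### Transfer between the given chain and path space. -/

section Transfer

variable {Ω S : Type*} [MeasurableSpace Ω] [MeasurableSpace S] {μ : Measure Ω}
  {ξ : ℤ → Ω → S} {f : S → ℝ}

theorem measurePreserving_path (hξ : ∀ n, Measurable (ξ n)) :
    MeasurePreserving (path ξ) μ (pathLaw ξ μ) :=
  (measurable_pi_lambda _ hξ).measurePreserving μ

omit [MeasurableSpace Ω] in
theorem comap_path_sigmaAt (k : ℤ) : (sigmaAt coord k).comap (path ξ) = sigmaAt ξ k := by
  rw [sigmaAt, MeasurableSpace.comap_comp]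
  rfl

omit [MeasurableSpace Ω] in
theorem comap_path_past (k : ℤ) : (past coord k).comap (path ξ) = past ξ k := by
  simp only [past, MeasurableSpace.comap_iSup, comap_path_sigmaAt]

theorem measurable_coord (n : ℤ) : Measurable (coord n : (ℤ → S) → S) := measurable_pi_apply n

variable [IsProbabilityMeasure μ]

theorem isProbabilityMeasure_pathLaw (hξ : ∀ n, Measurable (ξ n)) :
    IsProbabilityMeasure (pathLaw ξ μ) :=
  Measure.isProbabilityMeasure_map (measurable_pi_lambda _ hξ).aemeasurable

/-- The coordinate process under the law of a stationary Markov chain is one. -/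
theorem IsStationaryMarkovChain.coord (hξ : IsStationaryMarkovChain ξ μ) :
    IsStationaryMarkovChain coord (pathLaw ξ μ) where
  measurable := measurable_coord
  stationary := by rw [pathLaw_coord]; exact hξ.stationary
  markov n A hA := by
    have := isProbabilityMeasure_pathLaw (μ := μ) hξ.measurable
    have hp := measurePreserving_path (μ := μ) hξ.measurable
    have hpast : past TwoSidedChain.coord n ≤ (MeasurableSpace.pi : MeasurableSpace (ℤ → S)) :=
      past_le measurable_coord n
    have hσ : sigmaAt TwoSidedChain.coord n ≤ (MeasurableSpace.pi : MeasurableSpace (ℤ → S)) :=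
      sigmaAt_le measurable_coord n
    have hg : Integrable ((TwoSidedChain.coord (n + 1) ⁻¹' A).indicator fun _ => (1 : ℝ))
        (pathLaw ξ μ) := (integrable_const 1).indicator (measurable_coord _ hA)
    have h1 := condExp_comp_measurePreserving hp hpast hg
    have h2 := condExp_comp_measurePreserving hp hσ hg
    rw [comap_path_past] at h1
    rw [comap_path_sigmaAt] at h2
    have h3 := (h1.symm.trans (hξ.markov n A hA)).trans h2
    exact (ae_map_iff hp.aemeasurable (measurableSet_eq_fun
      (stronglyMeasurable_condExp.mono hpast).measurable
      (stronglyMeasurable_condExp.mono hσ).measurable)).2 h3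

omit [IsProbabilityMeasure μ] in
theorem integral_comp_path (hξ : ∀ n, Measurable (ξ n)) {F : Type*} [NormedAddCommGroup F]
    [NormedSpace ℝ F] {g : (ℤ → S) → F} (hg : StronglyMeasurable g) :
    ∫ ω, g (path ξ ω) ∂μ = ∫ x, g x ∂(pathLaw ξ μ) :=
  integral_comp_measurePreserving (measurePreserving_path hξ) hg.aestronglyMeasurable

theorem lpNorm_condExp_eq_twoSidedNorm (hξ : ∀ n, Measurable (ξ n))
    (hf : Integrable (obs f coord 0) (pathLaw ξ μ)) (k : ℕ) :
    lpNorm (μ[obs f ξ 0 | sigmaAt ξ (-(k : ℤ)) ⊔ sigmaAt ξ (k : ℤ)]) 2 μ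
      = twoSidedNorm f (pathLaw ξ μ) k := by
  have := isProbabilityMeasure_pathLaw (μ := μ) hξ
  have hp := measurePreserving_path (μ := μ) hξ
  have h := condExp_comp_measurePreserving hp (m := sigmaAt coord (-(k : ℤ)) ⊔ sigmaAt coord (k : ℤ))
    (sup_le (sigmaAt_le measurable_coord _) (sigmaAt_le measurable_coord _)) hf
  rw [MeasurableSpace.comap_sup, comap_path_sigmaAt, comap_path_sigmaAt] at h
  exact (lpNorm_two_congr_ae integrable_condExp.1 h).trans
    (lpNorm_comp_measurePreserving hp integrable_condExp.1)

end Transfer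

end TwoSidedChain

/-! ### The theorem for the original chain. -/

theorem corollary6 {Ω S : Type*} [MeasurableSpace Ω] [MeasurableSpace S]
    (μ : Measure Ω) [IsProbabilityMeasure μ] (ξ : ℤ → Ω → S) (f : S → ℝ)
    (hξ : TwoSidedChain.IsStationaryMarkovChain ξ μ)
    (herg : TwoSidedChain.TotallyErgodic ξ μ)
    (hf : TwoSidedChain.MemL20 f (μ.map (ξ 0)))
    (hsum : Summable fun k : ℕ =>
      lpNorm (μ[TwoSidedChain.obs f ξ 0 |
        TwoSidedChain.sigmaAt ξ (-((k : ℤ) + 1)) ⊔ TwoSidedChain.sigmaAt ξ ((k : ℤ) + 1)])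
        2 μ ^ 2) :
    (Summable fun k : ℕ =>
      ∫ ω, TwoSidedChain.obs f ξ 0 ω * TwoSidedChain.obs f ξ ((k : ℤ) + 1) ω ∂μ) ∧
    ∃ σsq : ℝ≥0,
      (σsq : ℝ) = lpNorm (TwoSidedChain.obs f ξ 0) 2 μ ^ 2 +
        2 * ∑' k : ℕ,
          ∫ ω, TwoSidedChain.obs f ξ 0 ω * TwoSidedChain.obs f ξ ((k : ℤ) + 1) ω ∂μ ∧
      Tendsto (fun n : ℕ => (∫ ω, TwoSidedChain.partialSum f ξ n ω ^ 2 ∂μ) / n)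
        atTop (𝓝 (σsq : ℝ)) ∧
      TendstoInDistribution
        (fun (n : ℕ) ω => TwoSidedChain.partialSum f ξ n ω / √(n : ℝ))
        atTop id (fun _ => μ) (gaussianReal 0 σsq) := by
  set P := TwoSidedChain.pathLaw ξ μ with hP
  have hprob : IsProbabilityMeasure P := TwoSidedChain.isProbabilityMeasure_pathLaw hξ.measurable
  have hpath := TwoSidedChain.measurePreserving_path (μ := μ) hξ.measurable
  have hξ' : TwoSidedChain.IsStationaryMarkovChain TwoSidedChain.coord P := hξ.coord
  have herg' : TwoSidedChain.TotallyErgodic TwoSidedChain.coord P := fun m hm => by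
    rw [TwoSidedChain.pathLaw_coord]
    exact herg m hm
  have hf' : TwoSidedChain.MemL20 f (P.map (TwoSidedChain.coord 0)) := by
    have : P.map (TwoSidedChain.coord 0) = μ.map (ξ 0) :=
      Measure.map_map (TwoSidedChain.measurable_coord 0) hpath.measurable
    rwa [this]
  have hX0 : MemLp (TwoSidedChain.obs f TwoSidedChain.coord 0) 2 P :=
    TwoSidedChain.memLp_obs hξ' hf' 0
  have hXm : ∀ k, StronglyMeasurable (TwoSidedChain.obs f (TwoSidedChain.coord (S := S)) k) :=
    fun k => (hf.measurable.comp (TwoSidedChain.measurable_coord k)).stronglyMeasurable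
  have hSm : ∀ n, StronglyMeasurable (TwoSidedChain.partialSum f (TwoSidedChain.coord (S := S)) n) :=
    fun n => Finset.stronglyMeasurable_fun_sum _ fun i _ => hXm i
  -- Summability over `k ≥ 1` is extended to `k ≥ 0` by adding one finite term.
  have hA : Summable fun k => TwoSidedChain.twoSidedNorm f P k ^ 2 := by
    refine (summable_nat_add_iff 1).1 (hsum.congr fun k => ?_)
    rw [← TwoSidedChain.lpNorm_condExp_eq_twoSidedNorm hξ.measurable (hX0.integrable (by simp)),
      Nat.cast_succ]
  have hcov : ∀ k : ℕ,
      ∫ ω, TwoSidedChain.obs f ξ 0 ω * TwoSidedChain.obs f ξ ((k : ℤ) + 1) ω ∂μ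
        = ∫ x, TwoSidedChain.obs f TwoSidedChain.coord 0 x
          * TwoSidedChain.obs f TwoSidedChain.coord ((k + 1 : ℕ) : ℤ) x ∂P := by
    intro k
    exact TwoSidedChain.integral_comp_path hξ.measurable ((hXm 0).mul (hXm ((k + 1 : ℕ) : ℤ)))
  have hvar : ∀ n : ℕ, ∫ ω, TwoSidedChain.partialSum f ξ n ω ^ 2 ∂μ
      = ∫ x, TwoSidedChain.partialSum f TwoSidedChain.coord n x ^ 2 ∂P := fun n =>
    TwoSidedChain.integral_comp_path hξ.measurable ((hSm n).pow 2)
  have hnorm : lpNorm (TwoSidedChain.obs f ξ 0) 2 μ ^ 2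
      = ∫ x, TwoSidedChain.obs f TwoSidedChain.coord 0 x ^ 2 ∂P := by
    rw [← TwoSidedChain.lpNorm_two_sq hX0,
      ← TwoSidedChain.lpNorm_comp_measurePreserving hpath hX0.1]
    rfl
  have hlim := TwoSidedChain.tendsto_integral_partialSum_sq_div hξ' hf' hA
  -- `σ²` is nonnegative as a limit of the nonnegative numbers `E(S_n²)/n`.
  obtain ⟨σsq, hσ⟩ := CanLift.prf (β := ℝ≥0) _ (ge_of_tendsto' hlim fun n =>
    div_nonneg (integral_nonneg fun _ => sq_nonneg _) (Nat.cast_nonneg n))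
  rw [← hσ] at hlim
  simp only [hcov, hvar, hnorm]
  refine ⟨(summable_nat_add_iff 1).2 (TwoSidedChain.summable_integral_obs_mul_obs hξ' hf' hA),
    σsq, hσ, hlim, ?_⟩
  have hmeas : ∀ n : ℕ, Measurable fun ω => TwoSidedChain.partialSum f ξ n ω / √(n : ℝ) :=
    fun n => ((hSm n).measurable.comp hpath.measurable).div_const _
  refine ⟨fun n => (hmeas n).aemeasurable, aemeasurable_id, ?_⟩
  -- Lévy's continuity theorem; `σ² = 0` needs no separate treatment, the limit being then the
  -- characteristic function of the point mass.
  refine ProbabilityMeasure.tendsto_iff_tendsto_charFun.2 fun t => ?_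
  have h := TwoSidedChain.tendsto_integral_exp_partialSum hξ' herg' hf' hA hlim t
  simp only [ProbabilityMeasure.coe_mk, Measure.map_id, charFun_gaussianReal]
  convert h using 2 with n
  · rw [charFun_apply_real, integral_map (hmeas n).aemeasurable (by fun_prop),
      ← TwoSidedChain.integral_comp_path hξ.measurable
        ((show Continuous fun y : ℝ => Complex.exp (Complex.I * (t / √(n : ℝ) * y : ℝ)) by
          fun_prop).comp_stronglyMeasurable (hSm n))]
    congr 1
    ext ω
    congr 1
    have : TwoSidedChain.partialSum f ξ n ω
        = TwoSidedChain.partialSum f TwoSidedChain.coord n (TwoSidedChain.path ξ ω) := rfl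
    rw [this]
    push_cast
    ring
  · push_cast
    congr 1
    simp
    ring
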